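/- Let $n\ge 1$ and let $M$ be a smooth $4n$-manifold with a (pseudo-)quaternionic Kähler structure of non-zero scalar curvature whose almost complex structures are defined on all of $M$ (this always holds locally). That is, $M$ carries a (pseudo-)Riemannian metric $g$, Hermitian with respect to almost complex structures $I_1,I_2,I_3$ with $I_1^2=I_2^2=I_3^2=-1$, $I_1I_2=I_3$; the smooth $\operatorname{Im}\mathbb H$-valued 2-form $\Theta=\Theta_1\mathbf i+\Theta_2\mathbf j+\Theta_3\mathbf k$, $\Theta_a(X,Y)=g(I_aX,Y)$; and a smooth $\operatorname{Im}\mathbb H$-valued 1-form $\omega$ with $d\omega+\omega\wedge\omega=s\,\Theta$ for a real constant $s\neq0$. Let $\mathcal U(M)=M\times\mathbb H^\times$ be its Swann bundle, with fibre coordinate $q$, with the action $(x,q)\mapsto(x,uq)$ of $u\in\mathbb H^\times$, and with the $\operatorname{Im}\mathbb H$-valued hyperkähler 2-form $$\Omega=s\,q\,\Theta\,\bar q+(dq-q\omega)\wedge\overline{(dq-q\omega)} .$$ (1) Let $X$ be a smooth vector field on $\mathcal U(M)$ that commutes with the $\mathbb H^\times$-action. Then $X=X_H+X_V$, where $X_H$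 is a smooth vector field on $M$ (the projection of $X$) and $X_V$ is the vertical vector field with $i_{X_V}dq=-qR$, for a smooth function $R:M\to\mathbb H$. Moreover the following are equivalent: (a) $\mathcal L_X\Omega=0$; (b) $R$ is $\operatorname{Im}\mathbb H$-valued and $\mathcal L_{X_H}\Theta=R\,\Theta-\Theta R$; (c) $R$ is $\operatorname{Im}\mathbb H$-valued and $dR+\omega R-R\,\omega=-\mathcal L_{X_H}\omega$. If they hold, then $X$ is tri-Hamiltonian with the $\operatorname{Im}\mathbb H$-valued moment map $\mu_X=q\,(i_{X_H}\omega+R)\,\bar q$, that is, $d\mu_X=-i_X\Omega$; and the function $\mu_{X_H}=i_{X_H}\omega+R$ on $M$ satisfies $$d\mu_{X_H}+\omega\,\mu_{X_H}-\mu_{X_H}\,\omega=-s\,i_{X_H}\Theta .$$ (2) Conversely, let $X_H$ be a smooth vector field on $M$ with $\mathcal L_{X_H}\Theta=R\,\Theta-\Theta R$ for some smooth $\operatorname{Im}\mathbb H$-valued function $R$ on $M$. Then there is exactly one smooth vector field $X$ on $\mathcal U(M)$ that commutes with the $\mathbb H^\times$-action, projects to $X_H$ and satisfies $\mathcal L_X\Omega=0$.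 Its vertical part is given by $i_{X_V}dq=-qR$, and it is tri-Hamiltonian with moment map $\mu_X=q\,(i_{X_H}\omega+R)\,\bar q$. -/

import Mathlib

open scoped Manifold ContDiff Quaternion

noncomputable section

namespace Swann

/-! ### Differential forms on manifolds -/

section Forms

variable {E H F N : Type*} [NormedAddCommGroup E] [NormedSpace ℝ E] [TopologicalSpace H]
  [NormedAddCommGroup F] [NormedSpace ℝ F] [TopologicalSpace N] [ChartedSpace H N]

/-- (Not necessarily smooth) `F`-valued differential `k`-forms on the manifold `N`. -/
abbrev Form (I : ModelWithCorners ℝ E H) (N : Type*) [TopologicalSpace N] [ChartedSpace H N]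
    (k : ℕ) (F : Type*) [NormedAddCommGroup F] [NormedSpace ℝ F] :=
  ∀ x : N, (TangentSpace I x) [⋀^Fin k]→L[ℝ] F

/-- (Not necessarily smooth) vector fields on the manifold `N`. -/
abbrev VField (I : ModelWithCorners ℝ E H) (N : Type*) [TopologicalSpace N] [ChartedSpace H N] :=
  ∀ x : N, TangentSpace I x

/-- The expression of the form `α` in the preferred chart at `x₀`: the pullback of `α` under the
inverse of the chart. It is meaningful on the target of the chart. -/
def Form.inChart {I : ModelWithCorners ℝ E H} {k : ℕ} (α : Form I N k F) (x₀ : N) :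
    E → E [⋀^Fin k]→L[ℝ] F := fun y =>
  (α ((extChartAt I x₀).symm y)).compContinuousLinearMap
    (mfderivWithin 𝓘(ℝ, E) I (extChartAt I x₀).symm (Set.range I) y)

/-- Smoothness of a differential form, in charts. -/
def Form.IsSmooth {I : ModelWithCorners ℝ E H} {k : ℕ} (α : Form I N k F) : Prop :=
  ∀ x₀ : N, ContDiffOn ℝ ∞ (α.inChart x₀) (extChartAt I x₀).target

/-- Smoothness of a vector field. -/
def VField.IsSmooth {I : ModelWithCorners ℝ E H} [IsManifold I 1 N] (X : VField I N) : Prop :=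
  ContMDiff I I.tangent ∞ (fun x => (⟨x, X x⟩ : TangentBundle I N))

/-- The exterior derivative of a differential form: at `x`, the exterior derivative of the
expression in the chart at `x`, pulled back by that chart. The normalization is
`(dα)(v, w) = D_v α(w) - D_w α(v)` for `1`-forms. -/
def Form.d {I : ModelWithCorners ℝ E H} {k : ℕ} (α : Form I N k F) : Form I N (k + 1) F :=
  fun x => (extDerivWithin (α.inChart x) (Set.range I) (extChartAt I x x)).compContinuousLinearMap
    (mfderiv I 𝓘(ℝ, E) (extChartAt I x) x)

/-- The differential of a function, as a `1`-form. -/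
def dFun (I : ModelWithCorners ℝ E H) (f : N → F) : Form I N 1 F := fun x =>
  ContinuousAlternatingMap.ofSubsingleton ℝ (TangentSpace I x) F (0 : Fin 1)
    (mfderiv I 𝓘(ℝ, F) f x)

/-- The contraction `i_X α`, that is `(i_X α)(v, …) = α(X, v, …)`. -/
def Form.contract {I : ModelWithCorners ℝ E H} {k : ℕ} (X : VField I N) (α : Form I N (k + 1) F) :
    Form I N k F := fun x =>
  ContinuousAlternatingMap.curryLeft (E := E) (α x) (X x)

/-- The contraction of a vector field with a `1`-form, as a function. -/
def Form.contractOne {I : ModelWithCorners ℝ E H} (X : VField I N) (α : Form I N 1 F) : N → F :=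
  fun x => α x ![X x]

/-- The Lie derivative of a differential form, `L_X α = d (i_X α) + i_X (d α)`. -/
def Form.lie {I : ModelWithCorners ℝ E H} {k : ℕ} (X : VField I N) (α : Form I N (k + 1) F) :
    Form I N (k + 1) F :=
  Form.d (Form.contract X α) + Form.contract X (Form.d α)

/-- The wedge product of two `ℍ`-valued alternating `1`-forms on a vector space,
`(a ∧ b)(v, w) = a(v) b(w) - a(w) b(v)`. -/
def wedgeAlt {V : Type*} [AddCommGroup V] [Module ℝ V] [TopologicalSpace V]
    (a b : V [⋀^Fin 1]→L[ℝ] ℍ[ℝ]) : V [⋀^Fin 2]→L[ℝ] ℍ[ℝ] :=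
  let a' : V →L[ℝ] ℍ[ℝ] := (ContinuousAlternatingMap.ofSubsingleton ℝ V ℍ[ℝ] (0 : Fin 1)).symm a
  let b' : V →L[ℝ] ℍ[ℝ] := (ContinuousAlternatingMap.ofSubsingleton ℝ V ℍ[ℝ] (0 : Fin 1)).symm b
  { toFun := fun v => a' (v 0) * b' (v 1) - a' (v 1) * b' (v 0)
    map_update_add' := by
      intro inst m i x y
      rw [Subsingleton.elim inst (instDecidableEqFin 2)]
      fin_cases i <;> simp [add_mul, mul_add] <;> abel
    map_update_smul' := by
      intro inst m i c x
      rw [Subsingleton.elim inst (instDecidableEqFin 2)]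
      fin_cases i <;> simp [smul_sub]
    map_eq_zero_of_eq' := by
      intro v i j h hij
      fin_cases i <;> fin_cases j <;> simp_all
    cont := by fun_prop }

theorem wedgeAlt_apply {V : Type*} [AddCommGroup V] [Module ℝ V] [TopologicalSpace V]
    (a b : V [⋀^Fin 1]→L[ℝ] ℍ[ℝ]) (v w : V) :
    wedgeAlt a b ![v, w] = a ![v] * b ![w] - a ![w] * b ![v] := by
  have h : ∀ (c : V [⋀^Fin 1]→L[ℝ] ℍ[ℝ]) (u : V),
      (ContinuousAlternatingMap.ofSubsingleton ℝ V ℍ[ℝ] (0 : Fin 1)).symm c u = c ![u] := by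
    intro c u
    change c _ = c _
    congr 1
    funext i
    fin_cases i
    rfl
  rw [← h, ← h, ← h, ← h]
  rfl

/-- The wedge product of two `ℍ`-valued `1`-forms. -/
def Form.wedge {I : ModelWithCorners ℝ E H} (α β : Form I N 1 ℍ[ℝ]) : Form I N 2 ℍ[ℝ] :=
  fun x => wedgeAlt (α x) (β x)

/-- The product `f α` of a quaternionic function and a quaternionic form. -/
def Form.mulLeft {I : ModelWithCorners ℝ E H} {k : ℕ} (f : N → ℍ[ℝ]) (α : Form I N k ℍ[ℝ]) :
    Form I N k ℍ[ℝ] := fun x =>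
  (ContinuousLinearMap.mul ℝ ℍ[ℝ] (f x)).compContinuousAlternatingMap (α x)

/-- The product `α f` of a quaternionic form and a quaternionic function. -/
def Form.mulRight {I : ModelWithCorners ℝ E H} {k : ℕ} (α : Form I N k ℍ[ℝ]) (f : N → ℍ[ℝ]) :
    Form I N k ℍ[ℝ] := fun x =>
  ((ContinuousLinearMap.mul ℝ ℍ[ℝ]).flip (f x)).compContinuousAlternatingMap (α x)

/-- Quaternionic conjugation as a real-linear map. -/
def starCLM : ℍ[ℝ] →L[ℝ] ℍ[ℝ] where
  toFun := star
  map_add' := star_add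
  map_smul' c x := by simp
  cont := continuous_star

/-- The quaternionic conjugate of a quaternionic form. -/
def Form.conj {I : ModelWithCorners ℝ E H} {k : ℕ} (α : Form I N k ℍ[ℝ]) :
    Form I N k ℍ[ℝ] := fun x =>
  starCLM.compContinuousAlternatingMap (α x)

end Forms

/-! ### Quaternionic Kähler structures -/

/-- A (pseudo-)quaternionic Kähler structure of non-zero scalar curvature on the manifold `M`, on
which the almost complex structures, and hence their `2`-forms, are assumed to be globally defined
(any quaternionic Kähler manifold has this property locally). It consists of a (pseudo-)Riemannian
metric `g`, Hermitian with respect to almost complex structures `I₁, I₂, I₃` that satisfy the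
quaternion relations, with `Im ℍ`-valued `2`-form `Θ = g(I₁·,·) i + g(I₂·,·) j + g(I₃·,·) k`, and
of an `Im ℍ`-valued connection `1`-form `ω` such that `dω + ω ∧ ω = s Θ` with a constant `s ≠ 0`.
Differentiating the last equation gives `dΘ + ω ∧ Θ - Θ ∧ ω = 0`. Smoothness of `Θ` is equivalent
to smoothness of `g, I₁, I₂, I₃`, as these are algebraic functions of the components of `Θ`. -/
structure QKStructure {E H : Type*} [NormedAddCommGroup E] [NormedSpace ℝ E] [TopologicalSpace H]
    (I : ModelWithCorners ℝ E H) (M : Type*) [TopologicalSpace M] [ChartedSpace H M] where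
  /-- The (pseudo-)Riemannian metric. -/
  g : ∀ x : M, TangentSpace I x →L[ℝ] TangentSpace I x →L[ℝ] ℝ
  g_symm : ∀ x v w, g x v w = g x w v
  g_nondegenerate : ∀ x v, (∀ w, g x v w = 0) → v = 0
  I₁ : ∀ x : M, TangentSpace I x →L[ℝ] TangentSpace I x
  I₂ : ∀ x : M, TangentSpace I x →L[ℝ] TangentSpace I x
  I₃ : ∀ x : M, TangentSpace I x →L[ℝ] TangentSpace I x
  I₁_sq : ∀ x v, I₁ x (I₁ x v) = -v
  I₂_sq : ∀ x v, I₂ x (I₂ x v) = -v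
  I₃_sq : ∀ x v, I₃ x (I₃ x v) = -v
  I₁_I₂ : ∀ x v, I₁ x (I₂ x v) = I₃ x v
  g_I₁ : ∀ x v w, g x (I₁ x v) (I₁ x w) = g x v w
  g_I₂ : ∀ x v w, g x (I₂ x v) (I₂ x w) = g x v w
  g_I₃ : ∀ x v w, g x (I₃ x v) (I₃ x w) = g x v w
  /-- The almost Kähler `2`-forms, assembled into an `Im ℍ`-valued `2`-form. -/
  Θ : Form I M 2 ℍ[ℝ]
  Θ_apply : ∀ x v w, Θ x ![v, w] = ⟨0, g x (I₁ x v) w, g x (I₂ x v) w, g x (I₃ x v) w⟩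
  Θ_smooth : Θ.IsSmooth
  /-- The `Sp(1)` connection `1`-form `ω`. -/
  conn : Form I M 1 ℍ[ℝ]
  conn_im : ∀ x v, (conn x ![v]).re = 0
  conn_smooth : conn.IsSmooth
  /-- The constant of proportionality between the `Sp(1)` curvature and `Θ`. -/
  s : ℝ
  s_ne_zero : s ≠ 0
  einstein : Form.d conn + Form.wedge conn conn = s • Θ

/-! ### The Swann bundle -/

section SwannBundle

variable {E H M : Type*} [NormedAddCommGroup E] [NormedSpace ℝ E] [TopologicalSpace H]
  {I : ModelWithCorners ℝ E H} [TopologicalSpace M] [ChartedSpace H M]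

/-- The pullback to `M × ℍˣ` of a form on `M` under the projection. -/
def Form.lift {k : ℕ} (α : Form I M k ℍ[ℝ]) : Form (I.prod 𝓘(ℝ, ℍ[ℝ])) (M × ℍ[ℝ]ˣ) k ℍ[ℝ] :=
  fun p => (α p.1).compContinuousLinearMap
    (mfderiv (I.prod 𝓘(ℝ, ℍ[ℝ])) I (Prod.fst : M × ℍ[ℝ]ˣ → M) p)

/-- The fibre coordinate `q : M × ℍˣ → ℍ`. -/
def fib (M : Type*) : M × ℍ[ℝ]ˣ → ℍ[ℝ] := fun p => (p.2 : ℍ[ℝ])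

/-- The `1`-form `dq` on `M × ℍˣ`. -/
def dq (I : ModelWithCorners ℝ E H) (M : Type*) [TopologicalSpace M] [ChartedSpace H M] :
    Form (I.prod 𝓘(ℝ, ℍ[ℝ])) (M × ℍ[ℝ]ˣ) 1 ℍ[ℝ] :=
  dFun (I.prod 𝓘(ℝ, ℍ[ℝ])) (fib M)

/-- The `1`-form `dq - q ω` on the Swann bundle. -/
def QKStructure.θ (Q : QKStructure I M) : Form (I.prod 𝓘(ℝ, ℍ[ℝ])) (M × ℍ[ℝ]ˣ) 1 ℍ[ℝ] :=
  dq I M - Form.mulLeft (fib M) Q.conn.lift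

/-- The `Im ℍ`-valued hyperkähler `2`-form of the Swann bundle `M × ℍˣ`,
`Ω = s q Θ q̄ + (dq - q ω) ∧ conj (dq - q ω)`. -/
def QKStructure.Ω (Q : QKStructure I M) : Form (I.prod 𝓘(ℝ, ℍ[ℝ])) (M × ℍ[ℝ]ˣ) 2 ℍ[ℝ] :=
  Q.s • Form.mulRight (Form.mulLeft (fib M) Q.Θ.lift) (fun p => star (fib M p)) +
    Form.wedge Q.θ Q.θ.conj

/-- The action `(x, q) ↦ (x, u q)` of `u ∈ ℍˣ` on the Swann bundle. -/
def act (u : ℍ[ℝ]ˣ) : M × ℍ[ℝ]ˣ → M × ℍ[ℝ]ˣ := fun p => (p.1, u * p.2)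

/-- The vector field `X` on the Swann bundle commutes with the action of `ℍˣ`, that is, it is
invariant under all the diffeomorphisms `act u`. -/
def CommutesWithAction (X : VField (I.prod 𝓘(ℝ, ℍ[ℝ])) (M × ℍ[ℝ]ˣ)) : Prop :=
  ∀ (u : ℍ[ℝ]ˣ) (p : M × ℍ[ℝ]ˣ),
    mfderiv (I.prod 𝓘(ℝ, ℍ[ℝ])) (I.prod 𝓘(ℝ, ℍ[ℝ])) (act u) p (X p) = X (act u p)

/-- `XH` is the horizontal part of `X`: at every point, `X` projects to `XH`. -/
def HasHorizontalPart (X : VField (I.prod 𝓘(ℝ, ℍ[ℝ])) (M × ℍ[ℝ]ˣ)) (XH : VField I M) : Prop :=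
  ∀ p : M × ℍ[ℝ]ˣ,
    mfderiv (I.prod 𝓘(ℝ, ℍ[ℝ])) I (Prod.fst : M × ℍ[ℝ]ˣ → M) p (X p) = XH p.1

/-- The vertical part of `X` is `-q R`: `dq(X) = -q R`. -/
def HasVerticalPart (X : VField (I.prod 𝓘(ℝ, ℍ[ℝ])) (M × ℍ[ℝ]ˣ)) (R : M → ℍ[ℝ]) : Prop :=
  ∀ p : M × ℍ[ℝ]ˣ, dq I M p ![X p] = -(fib M p * R p.1)

/-- `R` is `Im ℍ`-valued. -/
def IsIm {N : Type*} (R : N → ℍ[ℝ]) : Prop := ∀ x, (R x).re = 0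

/-- `X` preserves the hyperkähler forms: `L_X Ω = 0`. -/
def QKStructure.Preserves (Q : QKStructure I M)
    (X : VField (I.prod 𝓘(ℝ, ℍ[ℝ])) (M × ℍ[ℝ]ˣ)) : Prop :=
  Form.lie X Q.Ω = 0

/-- `L_{XH} Θ = R Θ - Θ R`. -/
def QKStructure.Rotates (Q : QKStructure I M) (XH : VField I M) (R : M → ℍ[ℝ]) : Prop :=
  Form.lie XH Q.Θ = Form.mulLeft R Q.Θ - Form.mulRight Q.Θ R

/-- The function `i_{XH} ω + R` on `M`. -/
def QKStructure.baseMoment (Q : QKStructure I M) (XH : VField I M) (R : M → ℍ[ℝ]) : M → ℍ[ℝ] :=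
  Form.contractOne XH Q.conn + R

/-- The function `q (i_{XH} ω + R) q̄` on the Swann bundle. -/
def QKStructure.moment (Q : QKStructure I M) (XH : VField I M) (R : M → ℍ[ℝ]) :
    M × ℍ[ℝ]ˣ → ℍ[ℝ] :=
  fun p => fib M p * Q.baseMoment XH R p.1 * star (fib M p)

/-- `μ` is a moment map for the tri-Hamiltonian vector field `X`: it is a smooth `Im ℍ`-valued
function with `dμ = -i_X Ω`. -/
def QKStructure.IsMomentMap (Q : QKStructure I M)
    (X : VField (I.prod 𝓘(ℝ, ℍ[ℝ])) (M × ℍ[ℝ]ˣ)) (μ : M × ℍ[ℝ]ˣ → ℍ[ℝ]) : Prop :=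
  ContMDiff (I.prod 𝓘(ℝ, ℍ[ℝ])) 𝓘(ℝ, ℍ[ℝ]) ∞ μ ∧ IsIm μ ∧
    dFun (I.prod 𝓘(ℝ, ℍ[ℝ])) μ = -Form.contract X Q.Ω

end SwannBundle

end Swann

end

noncomputable section

namespace Swann

/-! ### Exterior calculus on vector spaces and in charts -/

section Calculus

set_option linter.unusedSectionVars false

open Set Filter Topology

section VectorSpace

variable {E F : Type*} [NormedAddCommGroup E] [NormedSpace ℝ E]
  [NormedAddCommGroup F] [NormedSpace ℝ F]

/-! Everything is controlled by one `Im ℍ`-valued 1-form on the base, the defect `η = dm + ω m - m ω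
+ s i_{XH} Θ`, where `m = i_{XH} ω + R` (`QKStructure.defect`). Its vanishing is the asserted
equation for `m`.

On `M`, Cartan's formula and `dω = s Θ - ω ∧ ω` give `η = dR + ω R - R ω + L_{XH} ω` (`defect_eq`),
so (c) says that `R` is imaginary and `η = 0`. The covariant derivative of `η` is `s (L_{XH} Θ - (R
Θ - Θ R))` (`d_defect`), so `η = 0` implies the equation in (b). Conversely, (b) makes `η`
covariantly closed. Differentiating once more brings in the curvature `s Θ` and gives `Θ ∧ η - η ∧ Θ
= 0` (`wedge_defect_of_covariant_closed`). Pointwise linear algebra on a quaternionic line `v, I₁v,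
I₂v, I₃v` then forces `η = 0` (`eq_zero_of_wedge_commute`). This already works in dimension four.

On the Swann bundle, `Ω = d(q θ̄)` with `θ = dq - q ω`, hence `dΩ = 0` and `L_X Ω = d(i_X Ω)`.
Restricting `d(i_X Ω)` to vertical vectors shows that `L_X Ω = 0` forces `Re R = 0`
(`isIm_of_preserves`). For imaginary `R`, `i_X Ω = q η q̄ - dμ` with `μ = q m q̄`
(`contract_Ω_of_isIm`), so `L_X Ω = d(q η q̄)`. On a vertical and a horizontal vector at `q = 1`
this is `2 η`, so (a) is also equivalent to `R` imaginary and `η = 0`, and then `dμ = -i_X Ω`.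

An invariant field is determined by its values along the section `q = 1`, which yields `XH` and `R`.
For the converse, the field with parts `XH` and `-q R` is written down directly. It is unique
because the values of `Θ` at a point span `Im ℍ`, so `R` can be recovered from `R Θ - Θ R`. -/

theorem two_le_smooth : minSmoothness ℝ 2 ≤ ∞ := by
  rw [minSmoothness_of_isRCLikeNormedField]
  exact WithTop.coe_le_coe.2 le_top

theorem extDeriv_one_apply {a : E → E [⋀^Fin 1]→L[ℝ] F} {x : E} (ha : DifferentiableAt ℝ a x)
    (v w : E) :
    extDeriv a x ![v, w] =
      fderiv ℝ (fun y => a y ![w]) x v - fderiv ℝ (fun y => a y ![v]) x w := by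
  rw [extDeriv_apply ha]
  have h0 : (0 : Fin 2).removeNth ![v, w] = ![w] := by
    ext i; fin_cases i; rfl
  have h1 : (1 : Fin 2).removeNth ![v, w] = ![v] := by
    ext i; fin_cases i; rfl
  simp [Fin.sum_univ_two, h0, h1, sub_eq_add_neg]

theorem extDeriv_two_apply {a : E → E [⋀^Fin 2]→L[ℝ] F} {x : E} (ha : DifferentiableAt ℝ a x)
    (u v w : E) :
    extDeriv a x ![u, v, w] =
      fderiv ℝ (fun y => a y ![v, w]) x u - fderiv ℝ (fun y => a y ![u, w]) x v
        + fderiv ℝ (fun y => a y ![u, v]) x w := by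
  rw [extDeriv_apply ha]
  have h0 : (0 : Fin 3).removeNth ![u, v, w] = ![v, w] := by
    ext i; fin_cases i <;> rfl
  have h1 : (1 : Fin 3).removeNth ![u, v, w] = ![u, w] := by
    ext i; fin_cases i <;> rfl
  have h2 : (2 : Fin 3).removeNth ![u, v, w] = ![u, v] := by
    ext i; fin_cases i <;> rfl
  simp [Fin.sum_univ_three, h0, h1, h2, sub_eq_add_neg]

theorem differentiableAt_apply_const {k : ℕ} {a : E → E [⋀^Fin k]→L[ℝ] F} {x : E}
    (ha : DifferentiableAt ℝ a x) (v : Fin k → E) : DifferentiableAt ℝ (fun y => a y v) x :=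
  ha.continuousAlternatingMap_apply fun i => differentiableAt_const (v i)

/-- Writing the wedge product through bounded linear operators reduces its smooth dependence on the
two factors to smoothness of continuous linear maps. -/
theorem wedgeAlt_eq_alternatizeUncurryFin (a b : E [⋀^Fin 1]→L[ℝ] ℍ[ℝ]) :
    wedgeAlt a b = ContinuousAlternatingMap.alternatizeUncurryFinCLM ℝ E ℍ[ℝ]
      (((ContinuousAlternatingMap.ofSubsingletonLIE (𝕜 := ℝ) (E := E) (F := ℍ[ℝ])
        (0 : Fin 1)).toContinuousLinearEquiv : (E →L[ℝ] ℍ[ℝ]) →L[ℝ] _) ∘L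
        (((ContinuousLinearMap.compL ℝ E ℍ[ℝ] ℍ[ℝ]).flip
          ((ContinuousAlternatingMap.ofSubsingletonLIE (0 : Fin 1)).symm b)) ∘L
        (ContinuousLinearMap.mul ℝ ℍ[ℝ] ∘L
          ((ContinuousAlternatingMap.ofSubsingletonLIE (0 : Fin 1)).symm a)))) := by
  ext1 v
  rw [ContinuousAlternatingMap.alternatizeUncurryFinCLM_apply,
    ContinuousAlternatingMap.alternatizeUncurryFin_apply, Fin.sum_univ_two]
  simp only [Fin.val_zero, pow_zero, one_smul, Fin.val_one, pow_one, neg_smul, ← sub_eq_add_neg]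
  rfl

theorem contDiffOn_wedgeAlt {a b : E → E [⋀^Fin 1]→L[ℝ] ℍ[ℝ]} {s : Set E} {n : WithTop ℕ∞}
    (ha : ContDiffOn ℝ n a s) (hb : ContDiffOn ℝ n b s) :
    ContDiffOn ℝ n (fun y => wedgeAlt (a y) (b y)) s := by
  simp only [wedgeAlt_eq_alternatizeUncurryFin]
  have h : ∀ c : E → E [⋀^Fin 1]→L[ℝ] ℍ[ℝ], ContDiffOn ℝ n c s →
      ContDiffOn ℝ n (fun y => (ContinuousAlternatingMap.ofSubsingletonLIE (0 : Fin 1)).symm (c y))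
        s := fun c hc =>
    (ContinuousAlternatingMap.ofSubsingletonLIE (𝕜 := ℝ) (E := E) (F := ℍ[ℝ])
      (0 : Fin 1)).symm.contDiff.comp_contDiffOn hc
  have hL : ContDiff ℝ n (ContinuousAlternatingMap.alternatizeUncurryFinCLM (n := 1) ℝ E ℍ[ℝ]) :=
    ContinuousLinearMap.contDiff _
  refine hL.comp_contDiffOn ?_
  have hF : ContDiff ℝ n (ContinuousLinearMap.compL ℝ E ℍ[ℝ] ℍ[ℝ]).flip :=
    ContinuousLinearMap.contDiff _
  have h1 := (contDiffOn_const (c := ContinuousLinearMap.mul ℝ ℍ[ℝ])).clm_comp (h a ha)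
  exact contDiffOn_const.clm_comp ((hF.comp_contDiffOn (h b hb)).clm_comp h1)

theorem fderiv_mul_apply {f g : E → ℍ[ℝ]} {x : E} (hf : DifferentiableAt ℝ f x)
    (hg : DifferentiableAt ℝ g x) (v : E) :
    fderiv ℝ (fun y => f y * g y) x v = f x * fderiv ℝ g x v + fderiv ℝ f x v * g x := by
  have h := (hf.hasFDerivAt.mul' hg.hasFDerivAt).fderiv
  change fderiv ℝ (f * g) x v = _
  rw [h]
  simp

end VectorSpace

section Manifold

variable {E H F N : Type*} [NormedAddCommGroup E] [NormedSpace ℝ E] [TopologicalSpace H]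
  [NormedAddCommGroup F] [NormedSpace ℝ F] [TopologicalSpace N] [ChartedSpace H N]
  {I : ModelWithCorners ℝ E H}

namespace Form

variable {k : ℕ}

theorem inChart_add (α β : Form I N k F) (x₀ : N) :
    (α + β).inChart x₀ = α.inChart x₀ + β.inChart x₀ := rfl

theorem inChart_smul (c : ℝ) (α : Form I N k F) (x₀ : N) :
    (c • α).inChart x₀ = c • α.inChart x₀ := rfl

theorem inChart_wedge (α β : Form I N 1 ℍ[ℝ]) (x₀ : N) :
    (wedge α β).inChart x₀ = fun y => wedgeAlt (α.inChart x₀ y) (β.inChart x₀ y) := by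
  funext y
  ext1 v
  rfl

theorem inChart_apply (α : Form I N k F) (x₀ : N) (y : E) (v : Fin k → E) :
    α.inChart x₀ y v = α ((extChartAt I x₀).symm y)
      (fun i => mfderivWithin 𝓘(ℝ, E) I (extChartAt I x₀).symm (range I) y (v i)) := rfl

end Form

section Smooth

variable [I.Boundaryless] [IsManifold I ∞ N] {k : ℕ}

theorem contDiffOn_comp_extChartAt_symm {f : N → F} (hf : ContMDiff I 𝓘(ℝ, F) ∞ f) (x₀ : N) :
    ContDiffOn ℝ ∞ (fun y => f ((extChartAt I x₀).symm y)) (extChartAt I x₀).target :=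
  contMDiffOn_iff_contDiffOn.1 (hf.comp_contMDiffOn (contMDiffOn_extChartAt_symm x₀))

theorem mfderiv_extChartAt_eq_id (x : N) (v : E) : mfderiv I 𝓘(ℝ, E) (extChartAt I x) x v = v := by
  have : IsManifold I 1 N := IsManifold.of_le (n := ∞) (by simp)
  rw [mfderiv_extChartAt_self]
  rfl

theorem mfderivWithin_extChartAt_symm_eq_id (x : N) (v : E) :
    mfderivWithin 𝓘(ℝ, E) I (extChartAt I x).symm (range I) (extChartAt I x x) v = v := by
  have : IsManifold I 1 N := IsManifold.of_le (n := ∞) (by simp)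
  rw [mfderivWithin_range_extChartAt_symm]
  rfl

namespace Form

theorem inChart_self_apply (α : Form I N k F) (x : N) (v : Fin k → E) :
    α.inChart x (extChartAt I x x) v = α x v := by
  -- The base point of the chart expression equals `x` only propositionally, so the equality is
  -- generalised before substitution; all tangent spaces are the model space `E` by definition.
  have h : ∀ z, z = x → ∀ w : Fin k → E, α z w = α x w := by rintro z rfl w; rfl
  refine (h _ (extChartAt_to_inv x) _).trans ?_
  congr 1
  funext i
  exact mfderivWithin_extChartAt_symm_eq_id x (v i)

theorem d_apply (α : Form I N k F) (x : N) (v : Fin (k + 1) → E) :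
    Form.d α x v = extDeriv (α.inChart x) (extChartAt I x x) v := by
  have h : Form.d α x v = extDerivWithin (α.inChart x) (range I) (extChartAt I x x)
    (fun i => mfderiv I 𝓘(ℝ, E) (extChartAt I x) x (v i)) := rfl
  rw [h, I.range_eq_univ, extDerivWithin_univ]
  congr 1
  funext i
  exact mfderiv_extChartAt_eq_id x (v i)

theorem IsSmooth.contDiffAt {α : Form I N k F} (h : α.IsSmooth) {x₀ : N} {y : E}
    (hy : y ∈ (extChartAt I x₀).target) : ContDiffAt ℝ ∞ (α.inChart x₀) y :=
  (h x₀).contDiffAt ((isOpen_extChartAt_target x₀).mem_nhds hy)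

theorem IsSmooth.differentiableAt {α : Form I N k F} (h : α.IsSmooth) (x : N) :
    DifferentiableAt ℝ (α.inChart x) (extChartAt I x x) :=
  (h.contDiffAt (mem_extChartAt_target x)).differentiableAt (by simp)

/-- `Form.d` uses a different preferred chart at each point. Naturality of the exterior derivative
under the transition map `τ` shows that any one chart computes it on its whole target; smoothness of
`Form.d α` and `d ∘ d = 0` rest on this. -/
theorem inChart_d {α : Form I N k F} (h : α.IsSmooth) {x₀ : N} {y : E}
    (hy : y ∈ (extChartAt I x₀).target) :
    (Form.d α).inChart x₀ y = extDeriv (α.inChart x₀) y := by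
  have : IsManifold I 1 N := IsManifold.of_le (n := ∞) (by simp)
  set z : N := (extChartAt I x₀).symm y with hz
  set τ : E → E := extChartAt I z ∘ (extChartAt I x₀).symm with hτ
  have hsrc : ∀ y' ∈ (extChartAt I x₀).target, (extChartAt I x₀).symm y' ∈ (extChartAt I z).source →
      ContDiffAt ℝ ∞ τ y' ∧ fderiv ℝ τ y' =
        (mfderiv I 𝓘(ℝ, E) (extChartAt I z) ((extChartAt I x₀).symm y')).comp
          (mfderivWithin 𝓘(ℝ, E) I (extChartAt I x₀).symm (range I) y') := by
    intro y' hy' hs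
    constructor
    · have := contDiffWithinAt_ext_coord_change (n := ∞) (I := I) z x₀ (y := y') ⟨hy', hs⟩
      rwa [I.range_eq_univ, contDiffWithinAt_univ] at this
    · rw [← mfderiv_eq_fderiv, hτ, I.range_eq_univ, mfderivWithin_univ]
      apply mfderiv_comp
      · exact mdifferentiableAt_extChartAt (by rwa [← extChartAt_source I])
      · have := mdifferentiableWithinAt_extChartAt_symm (I := I) hy'
        rwa [I.range_eq_univ, mdifferentiableWithinAt_univ] at this
  -- Near `y`, the expression in the chart at `x₀` is the pullback under `τ` of the expression in
  -- the chart at `z`.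
  have hev : α.inChart x₀ =ᶠ[𝓝 y] fun y' =>
      (α.inChart z (τ y')).compContinuousLinearMap (fderiv ℝ τ y') := by
    have h1 : ∀ᶠ y' in 𝓝 y, y' ∈ (extChartAt I x₀).target :=
      (isOpen_extChartAt_target x₀).mem_nhds hy
    have h2 : ∀ᶠ y' in 𝓝 y, (extChartAt I x₀).symm y' ∈ (extChartAt I z).source :=
      (continuousAt_extChartAt_symm'' hy).eventually
        (extChartAt_source_mem_nhds (I := I) z)
    filter_upwards [h1, h2] with y' hy' hs
    rw [(hsrc y' hy' hs).2]
    ext1 v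
    rw [inChart_apply]
    have e : (extChartAt I z).symm (τ y') = (extChartAt I x₀).symm y' :=
      (extChartAt I z).left_inv hs
    have key : ∀ w : E, mfderivWithin 𝓘(ℝ, E) I (extChartAt I z).symm (range I) (τ y')
        (mfderiv I 𝓘(ℝ, E) (extChartAt I z) ((extChartAt I x₀).symm y') w) = w := by
      intro w
      have := mfderivWithin_extChartAt_symm_comp_mfderiv_extChartAt' (I := I) hs
      exact congrArg (fun L => L w) this
    have h : ∀ z', z' = (extChartAt I x₀).symm y' → ∀ w : Fin k → E,
      α z' w = α ((extChartAt I x₀).symm y') w := by rintro z' rfl w; rfl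
    refine Eq.trans ?_ (h _ e _).symm
    congr 1
    funext i
    exact (key _).symm
  have hzs : (extChartAt I x₀).symm y ∈ (extChartAt I z).source := mem_extChartAt_source z
  rw [hev.extDeriv_eq, extDeriv_pullback (r := ∞) ?_ (hsrc y hy hzs).1 ?_]
  · rw [(hsrc y hy hzs).2]
    simp only [inChart, Form.d, I.range_eq_univ, extDerivWithin_univ]
    rfl
  · exact h.differentiableAt z
  · exact two_le_smooth

theorem IsSmooth.d {α : Form I N k F} (h : α.IsSmooth) : (Form.d α).IsSmooth := by
  intro x₀
  refine ContDiffOn.congr ?_ fun y hy => inChart_d h hy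
  have hL : ContDiff ℝ ∞ (ContinuousAlternatingMap.alternatizeUncurryFinCLM (n := k) ℝ E F) :=
    ContinuousLinearMap.contDiff _
  refine hL.comp_contDiffOn ?_
  exact (h x₀).fderiv_of_isOpen (isOpen_extChartAt_target x₀) (by simp)

theorem d_d {α : Form I N k F} (h : α.IsSmooth) : Form.d (Form.d α) = 0 := by
  funext x
  refine ContinuousAlternatingMap.ext fun v => ?_
  have h0 : (Form.d α).inChart x =ᶠ[𝓝 (extChartAt I x x)] extDeriv (α.inChart x) := by
    filter_upwards [(isOpen_extChartAt_target x).mem_nhds (mem_extChartAt_target (I := I) x)]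
      with y hy using inChart_d h hy
  have h1 : extDeriv ((Form.d α).inChart x) (extChartAt I x x) = 0 := by
    rw [h0.extDeriv_eq, extDeriv_extDeriv_apply (h.contDiffAt (mem_extChartAt_target x))
      two_le_smooth]
  exact (d_apply (E := E) _ x v).trans (congrArg (fun L => L v) h1)

end Form

end Smooth

end Manifold

end Calculus

/-! ### Evaluation, smoothness and linearity for quaternionic forms -/

section FormCalculus

set_option linter.unusedSectionVars false

open Set Filter Topology

variable {E H F N : Type*} [NormedAddCommGroup E] [NormedSpace ℝ E] [TopologicalSpace H]
  [NormedAddCommGroup F] [NormedSpace ℝ F] [TopologicalSpace N] [ChartedSpace H N]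
  {I : ModelWithCorners ℝ E H}

section Postcomposition

variable {G K : Type*} [NormedAddCommGroup G] [NormedSpace ℝ G] [NormedAddCommGroup K]
  [NormedSpace ℝ K] {k : ℕ}

theorem contDiffOn_compContinuousAlternatingMap (B : F →L[ℝ] G →L[ℝ] K) {f : E → F}
    {a : E → E [⋀^Fin k]→L[ℝ] G} {s : Set E} {n : WithTop ℕ∞} (hf : ContDiffOn ℝ n f s)
    (ha : ContDiffOn ℝ n a s) :
    ContDiffOn ℝ n (fun y => (B (f y)).compContinuousAlternatingMap (a y)) s := by
  have hL : ContDiff ℝ n (ContinuousLinearMap.compContinuousAlternatingMapCLM ℝ E G K (Fin k)) :=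
    ContinuousLinearMap.contDiff _
  exact ((hL.comp B.contDiff).comp_contDiffOn hf).clm_apply ha

end Postcomposition

theorem ContMDiff.quaternion_mul {f g : N → ℍ[ℝ]} (hf : ContMDiff I 𝓘(ℝ, ℍ[ℝ]) ∞ f)
    (hg : ContMDiff I 𝓘(ℝ, ℍ[ℝ]) ∞ g) : ContMDiff I 𝓘(ℝ, ℍ[ℝ]) ∞ (fun x => f x * g x) := by
  have h : ContDiff ℝ ∞ (fun p : ℍ[ℝ] × ℍ[ℝ] => p.1 * p.2) := contDiff_fst.mul contDiff_snd
  exact h.comp_contMDiff (hf.prodMk_space hg)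

theorem ContMDiff.quaternion_star {f : N → ℍ[ℝ]} (hf : ContMDiff I 𝓘(ℝ, ℍ[ℝ]) ∞ f) :
    ContMDiff I 𝓘(ℝ, ℍ[ℝ]) ∞ (fun x => star (f x)) :=
  (ContinuousLinearMap.contDiff starCLM).comp_contMDiff hf

namespace Form

theorem ext_one {α β : Form I N 1 F} (h : ∀ x (v : TangentSpace I x), α x ![v] = β x ![v]) :
    α = β := by
  funext x
  refine ContinuousAlternatingMap.ext fun v => ?_
  have hv : v = ![v 0] := by
    funext i; fin_cases i; rfl
  rw [hv]
  exact h x _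

theorem ext_two {α β : Form I N 2 F}
    (h : ∀ x (v w : TangentSpace I x), α x ![v, w] = β x ![v, w]) : α = β := by
  funext x
  refine ContinuousAlternatingMap.ext fun v => ?_
  have hv : v = ![v 0, v 1] := by
    funext i; fin_cases i <;> rfl
  rw [hv]
  exact h x _ _

theorem add_apply {k : ℕ} (α β : Form I N k F) (x : N) (v : Fin k → TangentSpace I x) :
    (α + β) x v = α x v + β x v := rfl

theorem sub_apply {k : ℕ} (α β : Form I N k F) (x : N) (v : Fin k → TangentSpace I x) :
    (α - β) x v = α x v - β x v := rfl

theorem neg_apply {k : ℕ} (α : Form I N k F) (x : N) (v : Fin k → TangentSpace I x) :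
    (-α) x v = -α x v := rfl

theorem zero_apply {k : ℕ} (x : N) (v : Fin k → TangentSpace I x) :
    (0 : Form I N k F) x v = 0 := rfl

theorem smul_apply {k : ℕ} (c : ℝ) (α : Form I N k F) (x : N) (v : Fin k → TangentSpace I x) :
    (c • α) x v = c • α x v := rfl

theorem mulLeft_apply {k : ℕ} (f : N → ℍ[ℝ]) (α : Form I N k ℍ[ℝ]) (x : N)
    (v : Fin k → TangentSpace I x) : mulLeft f α x v = f x * α x v := rfl

theorem mulRight_apply {k : ℕ} (f : N → ℍ[ℝ]) (α : Form I N k ℍ[ℝ]) (x : N)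
    (v : Fin k → TangentSpace I x) : mulRight α f x v = α x v * f x := rfl

theorem conj_apply {k : ℕ} (α : Form I N k ℍ[ℝ]) (x : N)
    (v : Fin k → TangentSpace I x) : conj α x v = star (α x v) := rfl

theorem wedge_apply (α β : Form I N 1 ℍ[ℝ]) (x : N) (v w : TangentSpace I x) :
    wedge α β x ![v, w] = α x ![v] * β x ![w] - α x ![w] * β x ![v] :=
  wedgeAlt_apply _ _ _ _

/-- `wedge_apply` for a wedge product that is regarded as a form of degree `1 + 1`. -/
theorem wedge_apply_one_add_one (α β : Form I N 1 ℍ[ℝ]) (x : N) (v w : TangentSpace I x) :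
    @DFunLike.coe ((TangentSpace I x) [⋀^Fin (1 + 1)]→L[ℝ] ℍ[ℝ]) (Fin (1 + 1) → TangentSpace I x)
      (fun _ => ℍ[ℝ]) _ (wedge α β x) ![v, w] = α x ![v] * β x ![w] - α x ![w] * β x ![v] :=
  wedge_apply _ _ _ _ _

variable [I.Boundaryless] [IsManifold I ∞ N] {k : ℕ}

theorem IsSmooth.add {α β : Form I N k F} (hα : α.IsSmooth) (hβ : β.IsSmooth) :
    (α + β).IsSmooth := fun x₀ => (hα x₀).add (hβ x₀)

theorem IsSmooth.sub {α β : Form I N k F} (hα : α.IsSmooth) (hβ : β.IsSmooth) :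
    (α - β).IsSmooth := fun x₀ => (hα x₀).sub (hβ x₀)

theorem IsSmooth.neg {α : Form I N k F} (hα : α.IsSmooth) : (-α).IsSmooth :=
  fun x₀ => (hα x₀).neg

theorem IsSmooth.smul {α : Form I N k F} (hα : α.IsSmooth) (c : ℝ) : (c • α).IsSmooth :=
  fun x₀ => (contDiffOn_const (c := c)).smul (hα x₀)

theorem IsSmooth.mulLeft {f : N → ℍ[ℝ]} {α : Form I N k ℍ[ℝ]} (hf : ContMDiff I 𝓘(ℝ, ℍ[ℝ]) ∞ f)
    (hα : α.IsSmooth) : (Form.mulLeft f α).IsSmooth := fun x₀ => by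
  have h := contDiffOn_compContinuousAlternatingMap (k := k)
    (ContinuousLinearMap.mul ℝ ℍ[ℝ]) (contDiffOn_comp_extChartAt_symm hf x₀) (hα x₀)
  refine h.congr fun y _ => ContinuousAlternatingMap.ext fun v => ?_
  rfl

theorem IsSmooth.mulRight {f : N → ℍ[ℝ]} {α : Form I N k ℍ[ℝ]} (hα : α.IsSmooth)
    (hf : ContMDiff I 𝓘(ℝ, ℍ[ℝ]) ∞ f) : (Form.mulRight α f).IsSmooth := fun x₀ => by
  have h := contDiffOn_compContinuousAlternatingMap (k := k)
    (ContinuousLinearMap.mul ℝ ℍ[ℝ]).flip (contDiffOn_comp_extChartAt_symm hf x₀) (hα x₀)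
  refine h.congr fun y _ => ContinuousAlternatingMap.ext fun v => ?_
  rfl

theorem IsSmooth.wedge {α β : Form I N 1 ℍ[ℝ]} (hα : α.IsSmooth) (hβ : β.IsSmooth) :
    (Form.wedge α β).IsSmooth := fun x₀ => by
  rw [inChart_wedge]
  exact contDiffOn_wedgeAlt (hα x₀) (hβ x₀)

theorem d_add {α β : Form I N k F} (hα : α.IsSmooth) (hβ : β.IsSmooth) :
    Form.d (α + β) = Form.d α + Form.d β := by
  funext x
  refine ContinuousAlternatingMap.ext fun v => (d_apply (E := E) _ x v).trans ?_
  rw [inChart_add, extDeriv_add (hα.differentiableAt x) (hβ.differentiableAt x)]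
  exact (congrArg₂ (· + ·) (d_apply (E := E) α x v) (d_apply (E := E) β x v)).symm

theorem d_smul (c : ℝ) (α : Form I N k F) : Form.d (c • α) = c • Form.d α := by
  funext x
  refine ContinuousAlternatingMap.ext fun v => (d_apply (E := E) _ x v).trans ?_
  rw [inChart_smul, extDeriv_smul]
  exact (congrArg (c • ·) (d_apply (E := E) α x v)).symm

theorem d_neg (α : Form I N k F) : Form.d (-α) = -Form.d α := by
  have h := d_smul (-1 : ℝ) α
  simpa only [neg_one_smul] using h

theorem d_sub {α β : Form I N k F} (hα : α.IsSmooth) (hβ : β.IsSmooth) :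
    Form.d (α - β) = Form.d α - Form.d β := by
  rw [sub_eq_add_neg, d_add hα hβ.neg, d_neg, sub_eq_add_neg]

theorem d_zero : Form.d (0 : Form I N k F) = 0 := by
  have h := d_smul (0 : ℝ) (0 : Form I N k F)
  simpa only [zero_smul] using h

theorem dFun_eq_fderiv {f : N → F} (hf : ContMDiff I 𝓘(ℝ, F) ∞ f) (x : N) (v : E) :
    mfderiv I 𝓘(ℝ, F) f x v = fderiv ℝ (fun y => f ((extChartAt I x).symm y)) (extChartAt I x x) v
    := by
  have h : mfderiv I 𝓘(ℝ, F) f x =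
      (fderiv ℝ (fun y => f ((extChartAt I x).symm y)) (extChartAt I x x) : E →L[ℝ] F) := by
    refine (hf.mdifferentiableAt (by simp)).mfderiv.trans ?_
    rw [I.range_eq_univ, fderivWithin_univ]
    rfl
  exact congrArg (fun L : E →L[ℝ] F => L v) h

theorem _root_.Swann.dFun_apply (f : N → F) (x : N) (v : TangentSpace I x) :
    dFun I f x ![v] = mfderiv I 𝓘(ℝ, F) f x v := rfl

theorem dFun_inChart {f : N → F} (hf : ContMDiff I 𝓘(ℝ, F) ∞ f) {x₀ : N} {y : E}
    (hy : y ∈ (extChartAt I x₀).target) :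
    (dFun I f).inChart x₀ y = ContinuousAlternatingMap.ofSubsingletonLIE (0 : Fin 1)
      (fderiv ℝ (fun y => f ((extChartAt I x₀).symm y)) y) := by
  have : IsManifold I 1 N := IsManifold.of_le (n := ∞) (by simp)
  have h : mfderiv 𝓘(ℝ, E) 𝓘(ℝ, F) (f ∘ (extChartAt I x₀).symm) y =
      (mfderiv I 𝓘(ℝ, F) f ((extChartAt I x₀).symm y)).comp
        (mfderiv 𝓘(ℝ, E) I (extChartAt I x₀).symm y) := by
    apply mfderiv_comp
    · exact hf.mdifferentiableAt (by simp)
    · have := mdifferentiableWithinAt_extChartAt_symm (I := I) hy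
      rwa [I.range_eq_univ, mdifferentiableWithinAt_univ] at this
  rw [mfderiv_eq_fderiv] at h
  refine ContinuousAlternatingMap.ext fun v => ?_
  rw [inChart_apply, I.range_eq_univ, mfderivWithin_univ]
  exact (congrArg (fun L => L (v 0)) h).symm

theorem isSmooth_dFun {f : N → F} (hf : ContMDiff I 𝓘(ℝ, F) ∞ f) : (dFun I f).IsSmooth := by
  intro x₀
  refine ContDiffOn.congr ?_ fun y hy => dFun_inChart hf hy
  refine (ContinuousAlternatingMap.ofSubsingletonLIE (𝕜 := ℝ) (E := E) (F := F)
      (0 : Fin 1)).contDiff.comp_contDiffOn ?_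
  exact (contDiffOn_comp_extChartAt_symm hf x₀).fderiv_of_isOpen (isOpen_extChartAt_target x₀)
    (by simp)

end Form

end FormCalculus

/-! ### Leibniz rules for functions and 1-forms -/

section Leibniz

set_option linter.unusedSectionVars false

open Set Filter Topology

variable {E H F N : Type*} [NormedAddCommGroup E] [NormedSpace ℝ E] [TopologicalSpace H]
  [NormedAddCommGroup F] [NormedSpace ℝ F] [TopologicalSpace N] [ChartedSpace H N]
  {I : ModelWithCorners ℝ E H} [I.Boundaryless] [IsManifold I ∞ N] {k : ℕ}

theorem dFun_mul {f g : N → ℍ[ℝ]} (hf : ContMDiff I 𝓘(ℝ, ℍ[ℝ]) ∞ f)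
    (hg : ContMDiff I 𝓘(ℝ, ℍ[ℝ]) ∞ g) :
    dFun I (fun x => f x * g x) = Form.mulRight (dFun I f) g + Form.mulLeft f (dFun I g) := by
  refine Form.ext_one fun x v => ?_
  have h : ∀ {f : N → ℍ[ℝ]}, ContMDiff I 𝓘(ℝ, ℍ[ℝ]) ∞ f →
      DifferentiableAt ℝ (fun y => f ((extChartAt I x).symm y)) (extChartAt I x x) := fun hf =>
    ((contDiffOn_comp_extChartAt_symm hf x).contDiffAt ((isOpen_extChartAt_target x).mem_nhds
      (mem_extChartAt_target x))).differentiableAt (by simp)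
  rw [Form.add_apply, Form.mulRight_apply, Form.mulLeft_apply, dFun_apply, dFun_apply, dFun_apply]
  refine (Form.dFun_eq_fderiv (E := E) (ContMDiff.quaternion_mul hf hg) x v).trans ?_
  refine (fderiv_mul_apply (h hf) (h hg) v).trans ?_
  rw [extChartAt_to_inv]
  refine (add_comm _ _).trans ?_
  exact (congrArg₂ (· + ·) (congrArg (· * g x) (Form.dFun_eq_fderiv hf x v))
    (congrArg (f x * ·) (Form.dFun_eq_fderiv hg x v))).symm

theorem dFun_add {f g : N → F} (hf : ContMDiff I 𝓘(ℝ, F) ∞ f) (hg : ContMDiff I 𝓘(ℝ, F) ∞ g) :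
    dFun I (f + g) = dFun I f + dFun I g := by
  refine Form.ext_one fun x v => ?_
  have h := mfderiv_add (hf.mdifferentiableAt (x := x) (by simp))
    (hg.mdifferentiableAt (x := x) (by simp))
  exact congrArg (fun L : E →L[ℝ] F => L v) h

theorem dFun_star {f : N → ℍ[ℝ]} (hf : ContMDiff I 𝓘(ℝ, ℍ[ℝ]) ∞ f) :
    dFun I (fun x => star (f x)) = Form.conj (dFun I f) := by
  refine Form.ext_one fun x v => ?_
  have h := mfderiv_comp x (starCLM.differentiable.mdifferentiable (f x))
    (hf.mdifferentiableAt (x := x) (by simp))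
  rw [ContinuousLinearMap.mfderiv_eq] at h
  exact congrArg (fun L : E →L[ℝ] ℍ[ℝ] => L v) h

namespace Form

theorem d_dFun {f : N → F} (hf : ContMDiff I 𝓘(ℝ, F) ∞ f) : Form.d (dFun I f) = 0 := by
  have hc : ∀ x₀ : N, ∀ y, inChart (I := I) (k := 0)
      (fun x => ContinuousAlternatingMap.constOfIsEmpty ℝ (TangentSpace I x) (Fin 0) (f x)) x₀ y =
      ContinuousAlternatingMap.constOfIsEmpty ℝ E (Fin 0) (f ((extChartAt I x₀).symm y)) :=
    fun x₀ y => ContinuousAlternatingMap.ext fun v => rfl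
  -- Regarded as a 0-form, `f` has exterior derivative `dFun I f`, so the claim becomes `d ∘ d = 0`.
  set α : Form I N 0 F :=
    fun x => ContinuousAlternatingMap.constOfIsEmpty ℝ (TangentSpace I x) (Fin 0) (f x) with hα
  have hs : α.IsSmooth := fun x₀ => by
    refine ContDiffOn.congr ?_ fun y _ => hc x₀ y
    exact (ContinuousAlternatingMap.constOfIsEmptyLIE ℝ E F (Fin 0)).contDiff.comp_contDiffOn
      (contDiffOn_comp_extChartAt_symm hf x₀)
  rw [← d_d hs]
  congr 1
  refine ext_one fun x v => ?_
  refine (dFun_eq_fderiv hf x v).trans ?_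
  refine Eq.trans ?_ (d_apply (E := E) α x ![v]).symm
  rw [show α.inChart x = _ from funext (hc x), extDeriv_constOfIsEmpty]
  rfl

theorem d_zeroForm {α : Form I N 0 F} (f : N → F) (hα : ∀ x v, α x v = f x)
    (hf : ContMDiff I 𝓘(ℝ, F) ∞ f) : Form.d α = dFun I f := by
  refine ext_one fun x v => ?_
  refine (d_apply (E := E) α x ![v]).trans ?_
  have h : α.inChart x = fun y =>
      ContinuousAlternatingMap.constOfIsEmpty ℝ E (Fin 0) (f ((extChartAt I x).symm y)) :=
    funext fun y => ContinuousAlternatingMap.ext fun w => hα _ _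
  rw [h, extDeriv_constOfIsEmpty]
  exact (dFun_eq_fderiv hf x v).symm

theorem d_mulLeft {f : N → ℍ[ℝ]} {α : Form I N 1 ℍ[ℝ]} (hf : ContMDiff I 𝓘(ℝ, ℍ[ℝ]) ∞ f)
    (hα : α.IsSmooth) :
    Form.d (mulLeft f α) = wedge (dFun I f) α + mulLeft f (Form.d α) := by
  refine ext_two fun x v w => ?_
  have hff : DifferentiableAt ℝ (fun y => f ((extChartAt I x).symm y)) (extChartAt I x x) :=
    ((contDiffOn_comp_extChartAt_symm hf x).contDiffAt ((isOpen_extChartAt_target x).mem_nhds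
      (mem_extChartAt_target x))).differentiableAt (by simp)
  have hd := hα.differentiableAt x
  rw [add_apply, wedge_apply, mulLeft_apply]
  -- Tangent vectors are retyped as vectors of `E`, where the formulas in charts apply.
  suffices h : ∀ v w : E, Form.d (mulLeft f α) x ![v, w] = dFun I f x ![v] * α x ![w] -
      dFun I f x ![w] * α x ![v] + f x * Form.d α x ![v, w] from h v w
  intro v w
  refine (d_apply (E := E) _ x ![v, w]).trans ?_
  refine (extDeriv_one_apply ((IsSmooth.mulLeft hf hα).differentiableAt x) v w).trans ?_
  have key : ∀ u u' : E, fderiv ℝ (fun y => (mulLeft f α).inChart x y ![u]) (extChartAt I x x) u' =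
      f x * fderiv ℝ (fun y => α.inChart x y ![u]) (extChartAt I x x) u' +
        dFun I f x ![u'] * α x ![u] := by
    intro u u'
    refine (fderiv_mul_apply hff (differentiableAt_apply_const hd ![u]) u').trans ?_
    rw [extChartAt_to_inv]
    exact congrArg₂ (· + ·) rfl (congrArg₂ (· * ·) (dFun_eq_fderiv hf x u').symm
      (inChart_self_apply (E := E) α x ![u]))
  have h1 : Form.d α x ![v, w] =
      fderiv ℝ (fun y => α.inChart x y ![w]) (extChartAt I x x) v -
        fderiv ℝ (fun y => α.inChart x y ![v]) (extChartAt I x x) w :=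
    (d_apply (E := E) _ x ![v, w]).trans (extDeriv_one_apply hd v w)
  rw [h1, key, key, mul_sub]
  abel

theorem d_mulRight {f : N → ℍ[ℝ]} {α : Form I N 1 ℍ[ℝ]} (hα : α.IsSmooth)
    (hf : ContMDiff I 𝓘(ℝ, ℍ[ℝ]) ∞ f) :
    Form.d (mulRight α f) = mulRight (Form.d α) f - wedge α (dFun I f) := by
  refine ext_two fun x v w => ?_
  have hff : DifferentiableAt ℝ (fun y => f ((extChartAt I x).symm y)) (extChartAt I x x) :=
    ((contDiffOn_comp_extChartAt_symm hf x).contDiffAt ((isOpen_extChartAt_target x).mem_nhds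
      (mem_extChartAt_target x))).differentiableAt (by simp)
  have hd := hα.differentiableAt x
  rw [sub_apply, wedge_apply, mulRight_apply]
  suffices h : ∀ v w : E, Form.d (mulRight α f) x ![v, w] = Form.d α x ![v, w] * f x -
      (α x ![v] * dFun I f x ![w] - α x ![w] * dFun I f x ![v]) from h v w
  intro v w
  refine (d_apply (E := E) _ x ![v, w]).trans ?_
  refine (extDeriv_one_apply ((IsSmooth.mulRight hα hf).differentiableAt x) v w).trans ?_
  have key : ∀ u u' : E, fderiv ℝ (fun y => (mulRight α f).inChart x y ![u]) (extChartAt I x x) u' =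
      α x ![u] * dFun I f x ![u'] +
      fderiv ℝ (fun y => α.inChart x y ![u]) (extChartAt I x x) u' * f x := by
    intro u u'
    refine (fderiv_mul_apply (differentiableAt_apply_const hd ![u]) hff u').trans ?_
    rw [extChartAt_to_inv]
    exact congrArg₂ (· + ·) (congrArg₂ (· * ·) (inChart_self_apply (E := E) α x ![u])
      (dFun_eq_fderiv hf x u').symm) rfl
  have h1 : Form.d α x ![v, w] =
      fderiv ℝ (fun y => α.inChart x y ![w]) (extChartAt I x x) v -
        fderiv ℝ (fun y => α.inChart x y ![v]) (extChartAt I x x) w :=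
    (d_apply (E := E) _ x ![v, w]).trans (extDeriv_one_apply hd v w)
  rw [h1, key, key, sub_mul]
  abel

/-- This is `dα ∧ β - α ∧ dβ`, spelled out on three vectors because `Form.wedge` takes only 1-forms.
-/
theorem d_wedge_apply {α β : Form I N 1 ℍ[ℝ]} (hα : α.IsSmooth) (hβ : β.IsSmooth) (x : N)
    (u v w : TangentSpace I x) :
    Form.d (wedge α β) x ![u, v, w] =
      (Form.d α x ![u, v] * β x ![w] - Form.d α x ![u, w] * β x ![v]
        + Form.d α x ![v, w] * β x ![u])
      - (α x ![u] * Form.d β x ![v, w] - α x ![v] * Form.d β x ![u, w]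
        + α x ![w] * Form.d β x ![u, v]) := by
  have ha := hα.differentiableAt x
  have hb := hβ.differentiableAt x
  suffices h : ∀ u v w : E, Form.d (wedge α β) x ![u, v, w] =
      (Form.d α x ![u, v] * β x ![w] - Form.d α x ![u, w] * β x ![v]
        + Form.d α x ![v, w] * β x ![u])
      - (α x ![u] * Form.d β x ![v, w] - α x ![v] * Form.d β x ![u, w]
        + α x ![w] * Form.d β x ![u, v]) from h u v w
  intro u v w
  refine (d_apply (E := E) _ x ![u, v, w]).trans ?_
  refine (extDeriv_two_apply ((hα.wedge hβ).differentiableAt x) u v w).trans ?_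
  have key : ∀ p q r : E, fderiv ℝ (fun y => (wedge α β).inChart x y ![p, q])
      (extChartAt I x x) r =
      (α x ![p] * fderiv ℝ (fun y => β.inChart x y ![q]) (extChartAt I x x) r +
        fderiv ℝ (fun y => α.inChart x y ![p]) (extChartAt I x x) r * β x ![q]) -
      (α x ![q] * fderiv ℝ (fun y => β.inChart x y ![p]) (extChartAt I x x) r +
        fderiv ℝ (fun y => α.inChart x y ![q]) (extChartAt I x x) r * β x ![p]) := by
    intro p q r
    have hA : ∀ p, DifferentiableAt ℝ (fun y => α.inChart x y ![p]) (extChartAt I x x) :=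
      fun p => differentiableAt_apply_const ha ![p]
    have hB : ∀ p, DifferentiableAt ℝ (fun y => β.inChart x y ![p]) (extChartAt I x x) :=
      fun p => differentiableAt_apply_const hb ![p]
    have hA' : ∀ p : E, α.inChart x (extChartAt I x x) ![p] = α x ![p] := fun p =>
      inChart_self_apply (E := E) α x ![p]
    have hB' : ∀ p : E, β.inChart x (extChartAt I x x) ![p] = β x ![p] := fun p =>
      inChart_self_apply (E := E) β x ![p]
    have h0 : (fun y => (wedge α β).inChart x y ![p, q]) = fun y =>
        α.inChart x y ![p] * β.inChart x y ![q] - α.inChart x y ![q] * β.inChart x y ![p] := by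
      funext y
      rw [inChart_wedge, wedgeAlt_apply]
    rw [h0, ← hA', ← hA', ← hB', ← hB', ← fderiv_mul_apply (hA p) (hB q),
      ← fderiv_mul_apply (hA q) (hB p)]
    have := fderiv_sub ((hA p).mul (hB q)) ((hA q).mul (hB p))
    exact congrArg (fun L => L r) this
  have h1 : ∀ {γ : Form I N 1 ℍ[ℝ]}, γ.IsSmooth → ∀ p q : E, Form.d γ x ![p, q] =
      fderiv ℝ (fun y => γ.inChart x y ![q]) (extChartAt I x x) p -
        fderiv ℝ (fun y => γ.inChart x y ![p]) (extChartAt I x x) q := fun hγ p q =>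
    (d_apply (E := E) _ x ![p, q]).trans (extDeriv_one_apply (hγ.differentiableAt x) p q)
  rw [key, key, key, h1 hα, h1 hα, h1 hα, h1 hβ, h1 hβ, h1 hβ]
  noncomm_ring

end Form

end Leibniz

/-! ### Vector fields in charts and contractions -/

section VectorFields

set_option linter.unusedSectionVars false

open Set Filter Topology

variable {E H F N : Type*} [NormedAddCommGroup E] [NormedSpace ℝ E] [TopologicalSpace H]
  [NormedAddCommGroup F] [NormedSpace ℝ F] [TopologicalSpace N] [ChartedSpace H N]
  {I : ModelWithCorners ℝ E H} [I.Boundaryless] [IsManifold I ∞ N] {k : ℕ}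

/-- The expression of a vector field in the preferred chart at `x₀`. -/
def VField.inChart (X : VField I N) (x₀ : N) : E → E := fun y =>
  mfderiv I 𝓘(ℝ, E) (extChartAt I x₀) ((extChartAt I x₀).symm y) (X ((extChartAt I x₀).symm y))

theorem VField.mfderivWithin_inChart (X : VField I N) {x₀ : N} {y : E}
    (hy : y ∈ (extChartAt I x₀).target) :
    mfderivWithin 𝓘(ℝ, E) I (extChartAt I x₀).symm (range I) y (X.inChart x₀ y) =
      X ((extChartAt I x₀).symm y) :=
  congrArg (fun L => L (X ((extChartAt I x₀).symm y)))
    (mfderivWithin_extChartAt_symm_comp_mfderiv_extChartAt (I := I) hy)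

/-- Over the chart domain, the tangent bundle trivialization at `x₀` is the derivative of the chart
at `x₀`, so the fibre component of the smooth section is the chart expression of `X`. -/
theorem VField.IsSmooth.contDiffOn_inChart {X : VField I N} (hX : X.IsSmooth) (x₀ : N) :
    ContDiffOn ℝ ∞ (X.inChart x₀) (extChartAt I x₀).target := by
  have h1 : ContMDiffOn I 𝓘(ℝ, E) ∞
      (fun x => (trivializationAt E (TangentSpace I) x₀ ⟨x, X x⟩).2)
      (trivializationAt E (TangentSpace I) x₀).baseSet :=
    (Bundle.Trivialization.contMDiffOn_section_baseSet_iff _).1 hX.contMDiffOn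
  have h2 := h1.comp (contMDiffOn_extChartAt_symm (n := ∞) x₀) (fun y hy => by
    rw [TangentBundle.trivializationAt_baseSet, mem_preimage, ← extChartAt_source I]
    exact (extChartAt I x₀).map_target hy)
  refine (contMDiffOn_iff_contDiffOn.1 h2).congr fun y hy => ?_
  have hs : (extChartAt I x₀).symm y ∈ (chartAt H x₀).source := by
    rw [← extChartAt_source I]
    exact (extChartAt I x₀).map_target hy
  set z := (extChartAt I x₀).symm y
  have hb : z ∈ (trivializationAt E (TangentSpace I) x₀).baseSet := by
    rw [TangentBundle.trivializationAt_baseSet]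
    exact hs
  have h3 : (trivializationAt E (TangentSpace I) x₀).continuousLinearMapAt ℝ z (X z) =
      (trivializationAt E (TangentSpace I) x₀ ⟨z, X z⟩).2 := by
    rw [Bundle.Trivialization.continuousLinearMapAt_apply,
      Bundle.Trivialization.linearMapAt_apply, if_pos hb]
  exact (congrArg (fun L : TangentSpace I z →L[ℝ] E => L (X z))
    (TangentBundle.continuousLinearMapAt_trivializationAt hs)).symm.trans h3

theorem contMDiff_of_contDiffOn_extChartAt_symm {f : N → F}
    (hf : ∀ x₀ : N, ContDiffOn ℝ ∞ (fun y => f ((extChartAt I x₀).symm y))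
      (extChartAt I x₀).target) : ContMDiff I 𝓘(ℝ, F) ∞ f := by
  intro x
  have h1 := ((contMDiffOn_iff_contDiffOn.2 (hf x)).comp (contMDiffOn_extChartAt (I := I) (x := x))
    (fun z hz => (extChartAt I x).map_source (by rwa [extChartAt_source])))
  have h2 := h1.contMDiffAt (x := x) ((chartAt H x).open_source.mem_nhds (mem_chart_source H x))
  refine h2.congr_of_eventuallyEq ?_
  filter_upwards [(chartAt H x).open_source.mem_nhds (mem_chart_source H x)] with z hz
  rw [Function.comp_apply, (extChartAt I x).left_inv (by rwa [extChartAt_source])]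

namespace Form

theorem contract_apply (X : VField I N) (α : Form I N (k + 1) F) (x : N)
    (v : Fin k → TangentSpace I x) : contract X α x v = α x (Matrix.vecCons (X x) v) := rfl

theorem inChart_contract (X : VField I N) (α : Form I N (k + 1) F) {x₀ : N} {y : E}
    (hy : y ∈ (extChartAt I x₀).target) :
    (contract X α).inChart x₀ y = (α.inChart x₀ y).curryLeft (X.inChart x₀ y) := by
  refine ContinuousAlternatingMap.ext fun v => ?_
  rw [inChart_apply, contract_apply, ContinuousAlternatingMap.curryLeft_apply_apply, inChart_apply]
  congr 1
  funext i
  refine Fin.cases ?_ (fun j => rfl) i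
  exact (X.mfderivWithin_inChart hy).symm

theorem IsSmooth.contract {X : VField I N} {α : Form I N (k + 1) F} (hα : α.IsSmooth)
    (hX : X.IsSmooth) : (Form.contract X α).IsSmooth := fun x₀ => by
  refine ContDiffOn.congr ?_ fun y hy => inChart_contract X α hy
  have hL : ContDiff ℝ ∞ (ContinuousAlternatingMap.curryLeftLI (𝕜 := ℝ) (E := E) (F := F)
    (n := k)) := LinearIsometry.contDiff _
  exact (hL.comp_contDiffOn (hα x₀)).clm_apply (hX.contDiffOn_inChart x₀)

theorem contMDiff_contractOne {X : VField I N} {α : Form I N 1 F} (hα : α.IsSmooth)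
    (hX : X.IsSmooth) : ContMDiff I 𝓘(ℝ, F) ∞ (contractOne X α) := by
  refine contMDiff_of_contDiffOn_extChartAt_symm fun x₀ => ?_
  have h := ContinuousLinearEquiv.contDiff (n := ∞)
    (ContinuousAlternatingMap.constOfIsEmptyLIE ℝ E F (Fin 0)).symm.toContinuousLinearEquiv
  refine (h.comp_contDiffOn ((hα.contract hX) x₀)).congr fun y hy => ?_
  refine congrArg (α _) ?_
  funext i
  fin_cases i
  rfl

theorem d_contract_one {X : VField I N} {α : Form I N 1 F} (hα : α.IsSmooth)
    (hX : X.IsSmooth) : Form.d (contract X α) = dFun I (contractOne X α) := by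
  refine d_zeroForm _ (fun x v => ?_) (contMDiff_contractOne hα hX)
  refine congrArg (α x) ?_
  funext i
  fin_cases i
  rfl

end Form

end VectorFields

/-! ### Pointwise algebra of the quaternionic structure -/

section QuaternionicAlgebra

variable {E H M : Type*} [NormedAddCommGroup E] [NormedSpace ℝ E] [TopologicalSpace H]
  {I : ModelWithCorners ℝ E H} [TopologicalSpace M] [ChartedSpace H M]

namespace QKStructure

variable (Q : QKStructure I M) (x : M)

/-- Anticommutation is not an axiom: it follows from `(I₁ I₂)² = I₃² = -1` and the other two
squares. -/
theorem I₂_I₁ (v : TangentSpace I x) : Q.I₂ x (Q.I₁ x v) = -Q.I₃ x v := by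
  have h : ∀ u, Q.I₂ x (Q.I₁ x (Q.I₂ x u)) = Q.I₁ x u := by
    intro u
    have h1 := congrArg (Q.I₁ x) (Q.I₃_sq x u)
    rw [← Q.I₁_I₂ x u, ← Q.I₁_I₂, Q.I₁_sq, map_neg] at h1
    exact neg_injective h1
  have h2 := h (-Q.I₂ x v)
  rwa [map_neg, map_neg, map_neg, map_neg, Q.I₂_sq, map_neg, map_neg, neg_neg, Q.I₁_I₂] at h2

theorem I₁_I₃ (v : TangentSpace I x) : Q.I₁ x (Q.I₃ x v) = -Q.I₂ x v := by
  rw [← Q.I₁_I₂, Q.I₁_sq]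

theorem I₃_I₂ (v : TangentSpace I x) : Q.I₃ x (Q.I₂ x v) = -Q.I₁ x v := by
  rw [← Q.I₁_I₂, Q.I₂_sq, map_neg]

theorem I₃_I₁ (v : TangentSpace I x) : Q.I₃ x (Q.I₁ x v) = Q.I₂ x v := by
  rw [← Q.I₁_I₂, Q.I₂_I₁, map_neg, Q.I₁_I₃, neg_neg]

theorem I₂_I₃ (v : TangentSpace I x) : Q.I₂ x (Q.I₃ x v) = Q.I₁ x v := by
  rw [← Q.I₁_I₂, Q.I₂_I₁, Q.I₃_I₂, neg_neg]

/-- An isometry with square `-1` is skew for `g`. Together with the quaternion relations, this makes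
`v, I₁v, I₂v, I₃v` pairwise orthogonal. -/
theorem g_I₁_self (v : TangentSpace I x) : Q.g x (Q.I₁ x v) v = 0 := by
  have h := Q.g_I₁ x (Q.I₁ x v) v
  rw [Q.I₁_sq, map_neg, neg_apply, Q.g_symm x v] at h
  linarith

theorem g_I₂_self (v : TangentSpace I x) : Q.g x (Q.I₂ x v) v = 0 := by
  have h := Q.g_I₂ x (Q.I₂ x v) v
  rw [Q.I₂_sq, map_neg, neg_apply, Q.g_symm x v] at h
  linarith

theorem g_I₃_self (v : TangentSpace I x) : Q.g x (Q.I₃ x v) v = 0 := by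
  have h := Q.g_I₃ x (Q.I₃ x v) v
  rw [Q.I₃_sq, map_neg, neg_apply, Q.g_symm x v] at h
  linarith

theorem g_I₂_I₁ (v : TangentSpace I x) : Q.g x (Q.I₂ x v) (Q.I₁ x v) = 0 := by
  rw [← Q.g_I₂, Q.I₂_sq, Q.I₂_I₁, map_neg, map_neg, neg_apply, neg_neg,
    Q.g_symm, Q.g_I₃_self]

theorem g_I₃_I₁ (v : TangentSpace I x) : Q.g x (Q.I₃ x v) (Q.I₁ x v) = 0 := by
  rw [← Q.g_I₁, Q.I₁_sq, Q.I₁_I₃, map_neg, map_neg, neg_apply, neg_neg,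
    Q.g_I₂_self]

theorem g_I₃_I₂ (v : TangentSpace I x) : Q.g x (Q.I₃ x v) (Q.I₂ x v) = 0 := by
  rw [← Q.g_I₂, Q.I₂_sq, Q.I₂_I₃, map_neg, Q.g_I₁_self, neg_zero]

theorem g_I₁_I₂ (v : TangentSpace I x) : Q.g x (Q.I₁ x v) (Q.I₂ x v) = 0 := by
  rw [Q.g_symm, Q.g_I₂_I₁]

theorem g_I₁_I₃ (v : TangentSpace I x) : Q.g x (Q.I₁ x v) (Q.I₃ x v) = 0 := by
  rw [Q.g_symm, Q.g_I₃_I₁]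

theorem g_I₂_I₃ (v : TangentSpace I x) : Q.g x (Q.I₂ x v) (Q.I₃ x v) = 0 := by
  rw [Q.g_symm, Q.g_I₃_I₂]

theorem g_self_I₂ (v : TangentSpace I x) : Q.g x v (Q.I₂ x v) = 0 := by
  rw [Q.g_symm, Q.g_I₂_self]

theorem g_self_I₃ (v : TangentSpace I x) : Q.g x v (Q.I₃ x v) = 0 := by
  rw [Q.g_symm, Q.g_I₃_self]

theorem re_Θ (v w : TangentSpace I x) : (Q.Θ x ![v, w]).re = 0 := by
  rw [Q.Θ_apply]

theorem imI_Θ (v w : TangentSpace I x) : (Q.Θ x ![v, w]).imI = Q.g x (Q.I₁ x v) w := by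
  rw [Q.Θ_apply]

theorem imJ_Θ (v w : TangentSpace I x) : (Q.Θ x ![v, w]).imJ = Q.g x (Q.I₂ x v) w := by
  rw [Q.Θ_apply]

theorem imK_Θ (v w : TangentSpace I x) : (Q.Θ x ![v, w]).imK = Q.g x (Q.I₃ x v) w := by
  rw [Q.Θ_apply]

/-- Every vector is a combination of two non-null vectors. -/
theorem exists_nonnull_decomposition (v : TangentSpace I x) (hv : v ≠ 0) :
    ∃ a b : TangentSpace I x, Q.g x a a ≠ 0 ∧ Q.g x b b ≠ 0 ∧ v = (2⁻¹ : ℝ) • (a + b) := by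
  by_cases h0 : Q.g x v v = 0
  · obtain ⟨w, hw⟩ : ∃ w, Q.g x v w ≠ 0 := by
      by_contra hcon
      push Not at hcon
      exact hv (Q.g_nondegenerate x v hcon)
    -- For null `v`, `g(v ± t w, v ± t w) = t (± 2 g(v, w) + t g(w, w))`. The choice `t = g(v, w) /
    -- g(w, w)` makes the brackets `3 g(v, w)` and `-g(v, w)`; if `w` is null too, `t = 1` works.
    obtain ⟨t, ht, h1, h2⟩ : ∃ t : ℝ, t ≠ 0 ∧ 2 * Q.g x v w + t * Q.g x w w ≠ 0 ∧
        -2 * Q.g x v w + t * Q.g x w w ≠ 0 := by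
      by_cases hb : Q.g x w w = 0
      · refine ⟨1, one_ne_zero, ?_, ?_⟩ <;> simpa [hb] using hw
      · refine ⟨Q.g x v w / Q.g x w w, div_ne_zero hw hb, ?_, ?_⟩ <;> rw [div_mul_cancel₀ _ hb]
        · intro h
          exact hw (by linarith)
        · intro h
          exact hw (by linarith)
    refine ⟨v + t • w, v - t • w, ?_, ?_, ?_⟩
    · simp only [map_add, map_smul, add_apply, smul_apply,
        h0, smul_eq_mul, Q.g_symm x w v]
      intro h
      exact mul_ne_zero ht h1 (by linarith)
    · simp only [map_sub, map_smul, sub_apply, smul_apply,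
        h0, smul_eq_mul, Q.g_symm x w v]
      intro h
      exact mul_ne_zero ht h2 (by linarith)
    · rw [add_add_sub_cancel, ← two_smul ℝ v, smul_smul]
      norm_num
  · refine ⟨v, v, h0, h0, ?_⟩
    rw [← two_smul ℝ v, smul_smul]
    norm_num

theorem exists_nonnull [Nontrivial E] : ∃ v : TangentSpace I x, Q.g x v v ≠ 0 := by
  obtain ⟨v, hv⟩ := exists_ne (0 : E)
  obtain ⟨a, -, ha, -, -⟩ := Q.exists_nonnull_decomposition x v hv
  exact ⟨a, ha⟩

/-- An imaginary quaternion commuting with the values of `Θ` vanishes. -/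
theorem eq_zero_of_commute [Nontrivial E] {q : ℍ[ℝ]} (hq : q.re = 0)
    (h : ∀ v w, q * Q.Θ x ![v, w] = Q.Θ x ![v, w] * q) : q = 0 := by
  obtain ⟨v, hv⟩ := Q.exists_nonnull x
  -- These values of `Θ` are `g(v, v) i` and `g(v, v) j`. Commuting with `i` kills the `j` and `k`
  -- components of `q`, and commuting with `j` kills the `i` component.
  have h1 := h v (Q.I₁ x v)
  have h2 := h v (Q.I₂ x v)
  rw [Quaternion.ext_iff] at h1 h2
  simp only [Quaternion.re_mul, Quaternion.imI_mul, Quaternion.imJ_mul, Quaternion.imK_mul,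
    Q.re_Θ, Q.imI_Θ, Q.imJ_Θ, Q.imK_Θ, Q.g_I₁, Q.g_I₂, Q.g_I₂_I₁, Q.g_I₃_I₁, Q.g_I₁_I₂,
    Q.g_I₃_I₂] at h1 h2
  obtain ⟨-, -, h1j, h1k⟩ := h1
  obtain ⟨-, -, -, h2k⟩ := h2
  have hi : Q.g x v v * q.imI = 0 := by linarith
  have hj : Q.g x v v * q.imJ = 0 := by linarith
  have hk : Q.g x v v * q.imK = 0 := by linarith
  refine QuaternionAlgebra.ext hq ?_ ?_ ?_
  · exact (mul_eq_zero.1 hi).resolve_left hv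
  · exact (mul_eq_zero.1 hj).resolve_left hv
  · exact (mul_eq_zero.1 hk).resolve_left hv

/-- An imaginary `1`-form with `Θ ∧ η = η ∧ Θ` vanishes. -/
theorem eq_zero_of_wedge_commute (η : TangentSpace I x →L[ℝ] ℍ[ℝ]) (hη : ∀ v, (η v).re = 0)
    (h : ∀ u v w, (Q.Θ x ![u, v] * η w - η w * Q.Θ x ![u, v])
      - (Q.Θ x ![u, w] * η v - η v * Q.Θ x ![u, w])
      + (Q.Θ x ![v, w] * η u - η u * Q.Θ x ![v, w]) = 0) : η = 0 := by
  -- The four triples from `v, I₁v, I₂v, I₃v` give twelve linear equations for the twelve imaginary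
  -- components of `η` on this quaternionic line. Their coefficients are multiples of `g(v, v)`, and
  -- they determine `η v = 0`. Null vectors are then reached by linearity.
  have key : ∀ v, Q.g x v v ≠ 0 → η v = 0 := by
    intro v hv
    have h1 := h v (Q.I₁ x v) (Q.I₂ x v)
    have h2 := h v (Q.I₁ x v) (Q.I₃ x v)
    have h3 := h v (Q.I₂ x v) (Q.I₃ x v)
    have h4 := h (Q.I₁ x v) (Q.I₂ x v) (Q.I₃ x v)
    have r0 := hη v
    rw [Quaternion.ext_iff] at h1 h2 h3 h4
    simp only [Quaternion.re_mul, Quaternion.imI_mul, Quaternion.imJ_mul, Quaternion.imK_mul,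
      Quaternion.re_sub, Quaternion.imI_sub, Quaternion.imJ_sub, Quaternion.imK_sub,
      Quaternion.re_add, Quaternion.imI_add, Quaternion.imJ_add, Quaternion.imK_add,
      Quaternion.re_zero, Quaternion.imI_zero, Quaternion.imJ_zero, Quaternion.imK_zero,
      Q.re_Θ, Q.imI_Θ, Q.imJ_Θ, Q.imK_Θ, Q.I₁_sq, Q.I₂_sq, Q.I₁_I₂, Q.I₂_I₁, Q.I₃_I₁, Q.I₃_I₂,
      map_neg, neg_apply, Q.g_I₁, Q.g_I₂, Q.g_I₃, Q.g_I₂_I₁, Q.g_I₃_I₁, Q.g_I₁_I₂, Q.g_I₃_I₂,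
      Q.g_I₁_I₃, Q.g_I₂_I₃, Q.g_self_I₂, Q.g_self_I₃]
      at h1 h2 h3 h4
    obtain ⟨-, h1i, h1j, h1k⟩ := h1
    obtain ⟨-, h2i, h2j, h2k⟩ := h2
    obtain ⟨-, h3i, h3j, h3k⟩ := h3
    obtain ⟨-, h4i, h4j, h4k⟩ := h4
    have hi : Q.g x v v * (η v).imI = 0 := by linarith
    have hj : Q.g x v v * (η v).imJ = 0 := by linarith
    have hk : Q.g x v v * (η v).imK = 0 := by linarith
    refine QuaternionAlgebra.ext r0 ?_ ?_ ?_
    · exact (mul_eq_zero.1 hi).resolve_left hv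
    · exact (mul_eq_zero.1 hj).resolve_left hv
    · exact (mul_eq_zero.1 hk).resolve_left hv
  ext1 v
  by_cases hv : v = 0
  · rw [hv, map_zero, map_zero]
  · obtain ⟨a, b, ha, hb, hab⟩ := Q.exists_nonnull_decomposition x v hv
    rw [hab, map_smul, map_add, key a ha, key b hb, add_zero, smul_zero]
    rfl

end QKStructure

end QuaternionicAlgebra

/-! ### The defect form on the base -/

section Base

set_option linter.unusedSectionVars false

variable {E H M : Type*} [NormedAddCommGroup E] [NormedSpace ℝ E] [TopologicalSpace H]
  {I : ModelWithCorners ℝ E H} [TopologicalSpace M] [ChartedSpace H M]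

namespace QKStructure

variable (Q : QKStructure I M)

/-- The `1`-form `dm + ω m - m ω + s i_{XH} Θ`, where `m = i_{XH} ω + R`. -/
def defect (XH : VField I M) (R : M → ℍ[ℝ]) : Form I M 1 ℍ[ℝ] :=
  dFun I (Q.baseMoment XH R) + Form.mulRight Q.conn (Q.baseMoment XH R)
    - Form.mulLeft (Q.baseMoment XH R) Q.conn + Q.s • Form.contract XH Q.Θ

variable {Q}

theorem defect_eq_zero_iff {XH : VField I M} {R : M → ℍ[ℝ]} :
    Q.defect XH R = 0 ↔ dFun I (Q.baseMoment XH R) + Form.mulRight Q.conn (Q.baseMoment XH R)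
      - Form.mulLeft (Q.baseMoment XH R) Q.conn = -(Q.s • Form.contract XH Q.Θ) := by
  rw [defect, ← eq_neg_iff_add_eq_zero]

variable (Q) in
theorem d_conn_apply (x : M) (v w : TangentSpace I x) :
    Form.d Q.conn x ![v, w] = Q.s • Q.Θ x ![v, w] -
      (Q.conn x ![v] * Q.conn x ![w] - Q.conn x ![w] * Q.conn x ![v]) := by
  have h := congrArg (fun α : Form I M 2 ℍ[ℝ] => α x ![v, w]) Q.einstein
  simp only [Form.add_apply, Form.wedge_apply_one_add_one, Form.smul_apply] at h
  rw [← h, add_sub_cancel_right]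

variable [I.Boundaryless] [IsManifold I ∞ M] {XH : VField I M} {R : M → ℍ[ℝ]}

theorem contMDiff_baseMoment (hX : XH.IsSmooth) (hR : ContMDiff I 𝓘(ℝ, ℍ[ℝ]) ∞ R) :
    ContMDiff I 𝓘(ℝ, ℍ[ℝ]) ∞ (Q.baseMoment XH R) :=
  (Form.contMDiff_contractOne Q.conn_smooth hX).add hR

theorem isSmooth_defect (hX : XH.IsSmooth) (hR : ContMDiff I 𝓘(ℝ, ℍ[ℝ]) ∞ R) :
    (Q.defect XH R).IsSmooth := by
  have hm := contMDiff_baseMoment (Q := Q) hX hR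
  exact (((Form.isSmooth_dFun hm).add (Q.conn_smooth.mulRight hm)).sub
    (Form.IsSmooth.mulLeft hm Q.conn_smooth)).add ((Q.Θ_smooth.contract hX).smul Q.s)

/-- In `L_{XH} ω = d(i_{XH} ω) + i_{XH} dω`, the term `-i_{XH}(ω ∧ ω)` supplies the commutator of
`ω` with `i_{XH} ω`, which turns the commutator with `R` into the one with `m`. -/
theorem defect_eq (hX : XH.IsSmooth) (hR : ContMDiff I 𝓘(ℝ, ℍ[ℝ]) ∞ R) :
    Q.defect XH R = dFun I R + Form.mulRight Q.conn R - Form.mulLeft R Q.conn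
      + Form.lie XH Q.conn := by
  refine Form.ext_one fun x v => ?_
  have hm : dFun I (Q.baseMoment XH R) = dFun I (Form.contractOne XH Q.conn) + dFun I R :=
    dFun_add (Form.contMDiff_contractOne Q.conn_smooth hX) hR
  rw [defect, Form.lie, Form.d_contract_one Q.conn_smooth hX, hm]
  simp only [Form.add_apply, Form.sub_apply, Form.smul_apply, Form.mulRight_apply,
    Form.mulLeft_apply, Form.contract_apply]
  rw [Q.d_conn_apply x (XH x) v, baseMoment, Pi.add_apply, Form.contractOne]
  noncomm_ring

/-- The equation `dR + ω R - R ω = -L_{XH} ω` is the vanishing of the defect form. -/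
theorem defect_eq_zero_iff_lie (hX : XH.IsSmooth) (hR : ContMDiff I 𝓘(ℝ, ℍ[ℝ]) ∞ R) :
    Q.defect XH R = 0 ↔
      dFun I R + Form.mulRight Q.conn R - Form.mulLeft R Q.conn = -Form.lie XH Q.conn := by
  rw [defect_eq hX hR, ← eq_neg_iff_add_eq_zero]

/-- The Bianchi identity, obtained by differentiating the curvature equation. -/
theorem s_smul_d_Θ : Q.s • Form.d Q.Θ = Form.d (Form.wedge Q.conn Q.conn) := by
  rw [← Form.d_smul, ← Q.einstein,
    Form.d_add Q.conn_smooth.d (Q.conn_smooth.wedge Q.conn_smooth), Form.d_d Q.conn_smooth,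
    zero_add]

/-- The covariant derivative of the defect form measures the failure of
`L_{XH} Θ = R Θ - Θ R`. -/
theorem d_defect (hX : XH.IsSmooth) (hR : ContMDiff I 𝓘(ℝ, ℍ[ℝ]) ∞ R) :
    Form.d (Q.defect XH R) + Form.wedge Q.conn (Q.defect XH R) + Form.wedge (Q.defect XH R) Q.conn
      = Q.s • (Form.lie XH Q.Θ - (Form.mulLeft R Q.Θ - Form.mulRight Q.Θ R)) := by
  have hm := contMDiff_baseMoment (Q := Q) hX hR
  have hiΘ := (Q.Θ_smooth.contract hX).smul Q.s
  have hdη : Form.d (Q.defect XH R) =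
      (Form.mulRight (Form.d Q.conn) (Q.baseMoment XH R)
        - Form.wedge Q.conn (dFun I (Q.baseMoment XH R)))
      - (Form.wedge (dFun I (Q.baseMoment XH R)) Q.conn
        + Form.mulLeft (Q.baseMoment XH R) (Form.d Q.conn))
      + Form.d (Q.s • Form.contract XH Q.Θ) := by
    rw [defect, Form.d_add (((Form.isSmooth_dFun hm).add (Q.conn_smooth.mulRight hm)).sub
        (Form.IsSmooth.mulLeft hm Q.conn_smooth)) hiΘ,
      Form.d_sub ((Form.isSmooth_dFun hm).add (Q.conn_smooth.mulRight hm))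
        (Form.IsSmooth.mulLeft hm Q.conn_smooth),
      Form.d_add (Form.isSmooth_dFun hm) (Q.conn_smooth.mulRight hm), Form.d_dFun hm, zero_add,
      Form.d_mulRight Q.conn_smooth hm, Form.d_mulLeft hm Q.conn_smooth]
  refine Form.ext_two fun x v w => ?_
  have hdΘ : Q.s • Form.d Q.Θ x ![XH x, v, w] =
      Form.d (Form.wedge Q.conn Q.conn) x ![XH x, v, w] :=
    congrArg (fun α : Form I M 3 ℍ[ℝ] => α x ![XH x, v, w]) s_smul_d_Θ
  rw [Form.d_wedge_apply Q.conn_smooth Q.conn_smooth] at hdΘ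
  rw [hdη, Form.lie, Form.d_smul]
  simp only [Form.add_apply, Form.sub_apply, Form.smul_apply, Form.mulRight_apply,
    Form.mulLeft_apply, Form.contract_apply, Form.wedge_apply_one_add_one, defect,
    smul_sub, smul_add, hdΘ]
  -- Each `s Θ` is replaced by `dω + ω ∧ ω` and `R` by `m - i_{XH} ω`. What remains is an identity
  -- between noncommuting quaternions without scalars.
  rw [← mul_smul_comm, ← smul_mul_assoc]
  have e : ∀ a b : TangentSpace I x, Q.s • Q.Θ x ![a, b] = Form.d Q.conn x ![a, b] +
      (Q.conn x ![a] * Q.conn x ![b] - Q.conn x ![b] * Q.conn x ![a]) := fun a b => by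
    rw [Q.d_conn_apply, sub_add_cancel]
  rw [e, e, e]
  have hR' : R x = Q.baseMoment XH R x - Q.conn x ![XH x] := by
    rw [baseMoment, Pi.add_apply, Form.contractOne, add_sub_cancel_left]
  rw [hR']
  noncomm_ring

theorem baseMoment_re (hR : IsIm R) (x : M) : (Q.baseMoment XH R x).re = 0 := by
  rw [baseMoment, Pi.add_apply, Quaternion.re_add, hR x, Form.contractOne, Q.conn_im, add_zero]

end QKStructure

theorem re_dFun [I.Boundaryless] [IsManifold I ∞ M] {f : M → ℍ[ℝ]}
    (hf : ContMDiff I 𝓘(ℝ, ℍ[ℝ]) ∞ f) (h : IsIm f) (x : M) (v : TangentSpace I x) :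
    (dFun I f x ![v]).re = 0 := by
  have h1 : (fun x => star (f x)) = -f := by
    funext x
    exact Quaternion.star_eq_neg.2 (h x)
  have h2 := dFun_star hf
  rw [h1] at h2
  have h3 : dFun I (-f) x ![v] = -dFun I f x ![v] := by
    have := mfderiv_neg (I := I) (f := f) (x := x)
    exact congrArg (fun L : E →L[ℝ] ℍ[ℝ] => L v) this
  rw [h2, Form.conj_apply] at h3
  exact Quaternion.star_eq_neg.1 h3

namespace QKStructure

variable {Q : QKStructure I M} [I.Boundaryless] [IsManifold I ∞ M] {XH : VField I M} {R : M → ℍ[ℝ]}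

/-- `dm` and `Θ` are imaginary, and a commutator of quaternions has no real part. -/
theorem re_defect (hX : XH.IsSmooth) (hR : ContMDiff I 𝓘(ℝ, ℍ[ℝ]) ∞ R) (hIm : IsIm R) (x : M)
    (v : TangentSpace I x) : (Q.defect XH R x ![v]).re = 0 := by
  have h1 := re_dFun (contMDiff_baseMoment (Q := Q) hX hR) (baseMoment_re hIm) x v
  simp only [defect, Form.add_apply, Form.sub_apply, Form.smul_apply, Form.mulRight_apply,
    Form.mulLeft_apply, Form.contract_apply, Quaternion.re_add, Quaternion.re_sub,
    Quaternion.re_mul, Quaternion.re_smul, h1]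
  rw [Q.re_Θ x (XH x) v]
  simp
  ring

/-- The square of the covariant derivative is the commutator with the curvature `s Θ`, and `s ≠ 0`
can be cancelled. -/
theorem wedge_defect_of_covariant_closed (hX : XH.IsSmooth) (hR : ContMDiff I 𝓘(ℝ, ℍ[ℝ]) ∞ R)
    (h : Form.d (Q.defect XH R) + Form.wedge Q.conn (Q.defect XH R)
      + Form.wedge (Q.defect XH R) Q.conn = 0) (x : M) (u v w : TangentSpace I x) :
    (Q.Θ x ![u, v] * Q.defect XH R x ![w] - Q.defect XH R x ![w] * Q.Θ x ![u, v])
      - (Q.Θ x ![u, w] * Q.defect XH R x ![v] - Q.defect XH R x ![v] * Q.Θ x ![u, w])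
      + (Q.Θ x ![v, w] * Q.defect XH R x ![u] - Q.defect XH R x ![u] * Q.Θ x ![v, w]) = 0 := by
  have hη := isSmooth_defect (Q := Q) hX hR
  set η := Q.defect XH R
  have hdη : ∀ a b : TangentSpace I x, Form.d η x ![a, b] =
      -(Q.conn x ![a] * η x ![b] - Q.conn x ![b] * η x ![a])
      - (η x ![a] * Q.conn x ![b] - η x ![b] * Q.conn x ![a]) := fun a b => by
    have := congrArg (fun α : Form I M 2 ℍ[ℝ] => α x ![a, b]) h
    simp only [Form.add_apply, Form.wedge_apply_one_add_one, Form.zero_apply] at this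
    rw [← sub_eq_zero, ← this]
    abel
  have hdd := congrArg Form.d h
  rw [Form.d_add (hη.d.add (Q.conn_smooth.wedge hη)) (hη.wedge Q.conn_smooth),
    Form.d_add hη.d (Q.conn_smooth.wedge hη), Form.d_d hη, zero_add, Form.d_zero] at hdd
  have h3 := congrArg (fun α : Form I M 3 ℍ[ℝ] => α x ![u, v, w]) hdd
  simp only [Form.add_apply, Form.zero_apply] at h3
  rw [Form.d_wedge_apply Q.conn_smooth hη, Form.d_wedge_apply hη Q.conn_smooth] at h3
  simp only [hdη, Q.d_conn_apply] at h3
  refine (smul_eq_zero.1 ?_).resolve_left Q.s_ne_zero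
  rw [← h3]
  simp only [smul_add, smul_sub, ← mul_smul_comm]
  noncomm_ring

/-- If `R` is imaginary, `L_{XH} Θ = R Θ - Θ R` is equivalent to the vanishing of the defect. -/
theorem rotates_iff (hX : XH.IsSmooth) (hR : ContMDiff I 𝓘(ℝ, ℍ[ℝ]) ∞ R) (hIm : IsIm R) :
    Q.Rotates XH R ↔ Q.defect XH R = 0 := by
  have hd := d_defect (Q := Q) hX hR
  constructor
  · intro h
    rw [Rotates] at h
    rw [h, sub_self] at hd
    have hz : Q.s • (0 : Form I M 2 ℍ[ℝ]) = 0 := Form.ext_two fun x v w => by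
      rw [Form.smul_apply, Form.zero_apply, smul_zero]
    replace hd := hd.trans hz
    refine Form.ext_one fun x v => ?_
    set L := (ContinuousAlternatingMap.ofSubsingleton ℝ (TangentSpace I x) ℍ[ℝ] (0 : Fin 1)).symm
      (Q.defect XH R x) with hL
    have hLv : ∀ u, L u = Q.defect XH R x ![u] := fun u =>
      congrArg (Q.defect XH R x) (funext fun i => by fin_cases i; rfl)
    have h0 : L = 0 := by
      refine Q.eq_zero_of_wedge_commute x L (fun u => ?_) fun u v w => ?_
      · rw [hLv]
        exact re_defect hX hR hIm x u
      · rw [hLv, hLv, hLv]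
        exact wedge_defect_of_covariant_closed hX hR hd x u v w
    rw [← hLv, h0]
    rfl
  · intro h
    have h0 : Form.wedge Q.conn (0 : Form I M 1 ℍ[ℝ]) = 0 := by
      refine Form.ext_two fun x v w => ?_
      simp [Form.wedge_apply]
    have h1 : Form.wedge (0 : Form I M 1 ℍ[ℝ]) Q.conn = 0 := by
      refine Form.ext_two fun x v w => ?_
      simp [Form.wedge_apply]
    rw [h, h0, h1, Form.d_zero, add_zero, add_zero] at hd
    refine funext fun x => sub_eq_zero.1 ?_
    exact (smul_eq_zero.1 (congrFun hd.symm x)).resolve_left Q.s_ne_zero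

end QKStructure

end Base

/-! ### Pullback of forms to the Swann bundle -/

section Bundle

set_option linter.unusedSectionVars false

open Set Filter Topology

variable {E H M : Type*} [NormedAddCommGroup E] [NormedSpace ℝ E] [TopologicalSpace H]
  {I : ModelWithCorners ℝ E H} [TopologicalSpace M] [ChartedSpace H M]

section Lift

variable [I.Boundaryless] [IsManifold I ∞ M]

/-- Charts of the product are products of charts, so in charts the projection is the linear map `E ×
ℍ → E`. Smoothness of lifts and `d_lift` are then statements about pullback by a linear map. -/
theorem mfderivWithin_extChartAt_symm_fst (p : M × ℍ[ℝ]ˣ) {y : E × ℍ[ℝ]}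
    (hy : y ∈ (extChartAt (I.prod 𝓘(ℝ, ℍ[ℝ])) p).target) (v : E × ℍ[ℝ]) :
    mfderiv (I.prod 𝓘(ℝ, ℍ[ℝ])) I (Prod.fst : M × ℍ[ℝ]ˣ → M)
      ((extChartAt (I.prod 𝓘(ℝ, ℍ[ℝ])) p).symm y)
      (mfderivWithin 𝓘(ℝ, E × ℍ[ℝ]) (I.prod 𝓘(ℝ, ℍ[ℝ])) (extChartAt (I.prod 𝓘(ℝ, ℍ[ℝ])) p).symm
        (range (I.prod 𝓘(ℝ, ℍ[ℝ]))) y v) =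
    mfderivWithin 𝓘(ℝ, E) I (extChartAt I p.1).symm (range I) y.1 v.1 := by
  have : IsManifold I 1 M := IsManifold.of_le (n := ∞) (by simp)
  have hy1 : y.1 ∈ (extChartAt I p.1).target := by
    rw [extChartAt_prod] at hy
    exact hy.1
  have h1 : MDifferentiableAt 𝓘(ℝ, E × ℍ[ℝ]) (I.prod 𝓘(ℝ, ℍ[ℝ]))
      (extChartAt (I.prod 𝓘(ℝ, ℍ[ℝ])) p).symm y := by
    have := mdifferentiableWithinAt_extChartAt_symm (I := I.prod 𝓘(ℝ, ℍ[ℝ])) (x := p) hy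
    rwa [ModelWithCorners.range_eq_univ, mdifferentiableWithinAt_univ] at this
  have h2 : MDifferentiableAt 𝓘(ℝ, E) I (extChartAt I p.1).symm y.1 := by
    have := mdifferentiableWithinAt_extChartAt_symm (I := I) hy1
    rwa [ModelWithCorners.range_eq_univ, mdifferentiableWithinAt_univ] at this
  simp only [ModelWithCorners.range_eq_univ, mfderivWithin_univ]
  have e1 := mfderiv_comp (I := 𝓘(ℝ, E × ℍ[ℝ])) (I' := I.prod 𝓘(ℝ, ℍ[ℝ])) (I'' := I) y
    (g := (Prod.fst : M × ℍ[ℝ]ˣ → M)) mdifferentiableAt_fst h1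
  have h3 : MDifferentiableAt 𝓘(ℝ, E × ℍ[ℝ]) 𝓘(ℝ, E) (Prod.fst : E × ℍ[ℝ] → E) y :=
    differentiableAt_fst.mdifferentiableAt
  have e2 := mfderiv_comp (I := 𝓘(ℝ, E × ℍ[ℝ])) (I' := 𝓘(ℝ, E)) (I'' := I) y
    (g := (extChartAt I p.1).symm) (f := (Prod.fst : E × ℍ[ℝ] → E)) h2 h3
  have e3 : (Prod.fst : M × ℍ[ℝ]ˣ → M) ∘ (extChartAt (I.prod 𝓘(ℝ, ℍ[ℝ])) p).symm =
      (extChartAt I p.1).symm ∘ (Prod.fst : E × ℍ[ℝ] → E) := by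
    rw [extChartAt_prod]
    rfl
  have e4 : mfderiv 𝓘(ℝ, E × ℍ[ℝ]) 𝓘(ℝ, E) (Prod.fst : E × ℍ[ℝ] → E) y v = v.1 := by
    rw [mfderiv_eq_fderiv, fderiv_fst]
    rfl
  have e5 := congrArg (fun L : E × ℍ[ℝ] →L[ℝ] E => L v) e1
  have e6 := congrArg (fun L : E × ℍ[ℝ] →L[ℝ] E => L v) e2
  rw [e3] at e5
  refine e5.symm.trans (e6.trans ?_)
  exact congrArg (mfderiv 𝓘(ℝ, E) I (extChartAt I p.1).symm y.1) e4

namespace Form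

variable {k : ℕ}

theorem inChart_lift (α : Form I M k ℍ[ℝ]) (p : M × ℍ[ℝ]ˣ) {y : E × ℍ[ℝ]}
    (hy : y ∈ (extChartAt (I.prod 𝓘(ℝ, ℍ[ℝ])) p).target) :
    α.lift.inChart p y =
      (α.inChart p.1 y.1).compContinuousLinearMap (ContinuousLinearMap.fst ℝ E ℍ[ℝ]) := by
  refine ContinuousAlternatingMap.ext fun v => ?_
  have e3 : ((extChartAt (I.prod 𝓘(ℝ, ℍ[ℝ])) p).symm y).1 = (extChartAt I p.1).symm y.1 := by
    rw [extChartAt_prod]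
    rfl
  have h : ∀ i, mfderiv (I.prod 𝓘(ℝ, ℍ[ℝ])) I (Prod.fst : M × ℍ[ℝ]ˣ → M)
      ((extChartAt (I.prod 𝓘(ℝ, ℍ[ℝ])) p).symm y)
      (mfderivWithin 𝓘(ℝ, E × ℍ[ℝ]) (I.prod 𝓘(ℝ, ℍ[ℝ])) (extChartAt (I.prod 𝓘(ℝ, ℍ[ℝ])) p).symm
        (range (I.prod 𝓘(ℝ, ℍ[ℝ]))) y (v i)) = _ :=
    fun i => mfderivWithin_extChartAt_symm_fst p hy (v i)
  exact congrArg (α ((extChartAt I p.1).symm y.1)) (funext h)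

theorem IsSmooth.lift {α : Form I M k ℍ[ℝ]} (hα : α.IsSmooth) : α.lift.IsSmooth := by
  intro p
  have hL : ContDiff ℝ ∞ (ContinuousAlternatingMap.compContinuousLinearMapCLM (ι := Fin k)
    (ContinuousLinearMap.fst ℝ E ℍ[ℝ]) : (E [⋀^Fin k]→L[ℝ] ℍ[ℝ]) →L[ℝ] (E × ℍ[ℝ]) [⋀^Fin k]→L[ℝ] ℍ[ℝ]) := ContinuousLinearMap.contDiff _
  refine ((hL.comp_contDiffOn ((hα p.1).comp contDiff_fst.contDiffOn
    (s := (extChartAt (I.prod 𝓘(ℝ, ℍ[ℝ])) p).target) ?_))).congr fun y hy => inChart_lift α p hy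
  intro y hy
  rw [extChartAt_prod] at hy
  exact hy.1

theorem d_lift {α : Form I M k ℍ[ℝ]} (hα : α.IsSmooth) :
    Form.d α.lift = (Form.d α).lift := by
  funext p
  refine ContinuousAlternatingMap.ext fun v => ?_
  suffices h : ∀ v : Fin (k + 1) → E × ℍ[ℝ], Form.d α.lift p v = (Form.d α).lift p v from h v
  intro v
  rw [Form.d_apply]
  have h1 : α.lift.inChart p =ᶠ[𝓝 (extChartAt (I.prod 𝓘(ℝ, ℍ[ℝ])) p p)]
      fun y => (α.inChart p.1 y.1).compContinuousLinearMap (fderiv ℝ Prod.fst y) := by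
    filter_upwards [extChartAt_target_mem_nhds (I := I.prod 𝓘(ℝ, ℍ[ℝ])) p] with y hy
    rw [inChart_lift α p hy, fderiv_fst]
  have hfst : ContDiffAt ℝ ∞ (Prod.fst : E × ℍ[ℝ] → E) (extChartAt (I.prod 𝓘(ℝ, ℍ[ℝ])) p p) :=
    contDiffAt_fst
  have hd : DifferentiableAt ℝ (α.inChart p.1)
      (Prod.fst (extChartAt (I.prod 𝓘(ℝ, ℍ[ℝ])) p p : E × ℍ[ℝ])) := hα.differentiableAt p.1
  have h2 := extDeriv_pullback hd hfst two_le_smooth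
  rw [h1.extDeriv_eq, h2, fderiv_fst]
  have h3 := Form.d_apply (I := I) α p.1 (fun i => (v i).1)
  refine Eq.trans ?_ (h3.symm.trans ?_)
  · rfl
  · have h4 : ∀ i, mfderiv (I.prod 𝓘(ℝ, ℍ[ℝ])) I (Prod.fst : M × ℍ[ℝ]ˣ → M) p (v i) = (v i).1 :=
      fun i => by rw [mfderiv_fst]; rfl
    exact congrArg (Form.d α p.1) (funext fun i => (h4 i).symm)

end Form

end Lift

end Bundle

/-! ### The hyperkähler form and its exactness -/

section Total

set_option linter.unusedSectionVars false

open Set Filter Topology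

variable {E H M : Type*} [NormedAddCommGroup E] [NormedSpace ℝ E] [TopologicalSpace H]
  {I : ModelWithCorners ℝ E H} [TopologicalSpace M] [ChartedSpace H M]

theorem Form.lift_one_apply (α : Form I M 1 ℍ[ℝ]) (p : M × ℍ[ℝ]ˣ)
    (v : TangentSpace (I.prod 𝓘(ℝ, ℍ[ℝ])) p) :
    α.lift p ![v] =
      α p.1 ![mfderiv (I.prod 𝓘(ℝ, ℍ[ℝ])) I (Prod.fst : M × ℍ[ℝ]ˣ → M) p v] :=
  congrArg (α p.1) (funext fun i => by fin_cases i; rfl)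

theorem Form.lift_two_apply (α : Form I M 2 ℍ[ℝ]) (p : M × ℍ[ℝ]ˣ)
    (v w : TangentSpace (I.prod 𝓘(ℝ, ℍ[ℝ])) p) :
    α.lift p ![v, w] =
      α p.1 ![mfderiv (I.prod 𝓘(ℝ, ℍ[ℝ])) I (Prod.fst : M × ℍ[ℝ]ˣ → M) p v,
        mfderiv (I.prod 𝓘(ℝ, ℍ[ℝ])) I (Prod.fst : M × ℍ[ℝ]ˣ → M) p w] :=
  congrArg (α p.1) (funext fun i => by fin_cases i <;> rfl)

theorem Form.lift_one_add_one_apply (α : Form I M (1 + 1) ℍ[ℝ]) (p : M × ℍ[ℝ]ˣ)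
    (v w : TangentSpace (I.prod 𝓘(ℝ, ℍ[ℝ])) p) :
    α.lift p ![v, w] =
      α p.1 ![mfderiv (I.prod 𝓘(ℝ, ℍ[ℝ])) I (Prod.fst : M × ℍ[ℝ]ˣ → M) p v,
        mfderiv (I.prod 𝓘(ℝ, ℍ[ℝ])) I (Prod.fst : M × ℍ[ℝ]ˣ → M) p w] :=
  Form.lift_two_apply α p v w

theorem contMDiff_fib : ContMDiff (I.prod 𝓘(ℝ, ℍ[ℝ])) 𝓘(ℝ, ℍ[ℝ]) ∞ (fib M) :=
  Units.contMDiff_val.comp contMDiff_snd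

theorem mfderiv_fst_apply (p : M × ℍ[ℝ]ˣ) (v : E × ℍ[ℝ]) :
    mfderiv (I.prod 𝓘(ℝ, ℍ[ℝ])) I (Prod.fst : M × ℍ[ℝ]ˣ → M) p v = v.1 := by
  rw [mfderiv_fst]
  rfl

/-- The inclusion `ℍˣ → ℍ` is itself the preferred chart at every point. -/
theorem mfderiv_units_val (u : ℍ[ℝ]ˣ) (h : ℍ[ℝ]) :
    mfderiv 𝓘(ℝ, ℍ[ℝ]) 𝓘(ℝ, ℍ[ℝ]) (Units.val : ℍ[ℝ]ˣ → ℍ[ℝ]) u h = h :=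
  mfderiv_extChartAt_eq_id (I := 𝓘(ℝ, ℍ[ℝ])) u h

theorem dq_apply (p : M × ℍ[ℝ]ˣ) (v : E × ℍ[ℝ]) : dq I M p ![v] = v.2 := by
  have h1 : MDifferentiableAt 𝓘(ℝ, ℍ[ℝ]) 𝓘(ℝ, ℍ[ℝ]) (Units.val : ℍ[ℝ]ˣ → ℍ[ℝ]) p.2 :=
    (Units.contMDiff_val (n := ∞)).mdifferentiableAt (by simp)
  have h := mfderiv_comp (I := I.prod 𝓘(ℝ, ℍ[ℝ])) p h1
    (mdifferentiableAt_snd (I := I) (I' := 𝓘(ℝ, ℍ[ℝ])) (x := p))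
  have h2 := congrArg (fun L : E × ℍ[ℝ] →L[ℝ] ℍ[ℝ] => L v) h
  rw [mfderiv_snd] at h2
  exact h2.trans (mfderiv_units_val p.2 v.2)

theorem tangent_ext {p : M × ℍ[ℝ]ˣ} {v w : TangentSpace (I.prod 𝓘(ℝ, ℍ[ℝ])) p}
    (h1 : mfderiv (I.prod 𝓘(ℝ, ℍ[ℝ])) I (Prod.fst : M × ℍ[ℝ]ˣ → M) p v =
      mfderiv (I.prod 𝓘(ℝ, ℍ[ℝ])) I (Prod.fst : M × ℍ[ℝ]ˣ → M) p w)
    (h2 : dq I M p ![v] = dq I M p ![w]) : v = w :=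
  Prod.ext ((mfderiv_fst_apply p v).symm.trans (h1.trans (mfderiv_fst_apply p w)))
    ((dq_apply p v).symm.trans (h2.trans (dq_apply p w)))

theorem exists_tangent (p : M × ℍ[ℝ]ˣ) (a : TangentSpace I p.1) (h : ℍ[ℝ]) :
    ∃ v : TangentSpace (I.prod 𝓘(ℝ, ℍ[ℝ])) p,
      mfderiv (I.prod 𝓘(ℝ, ℍ[ℝ])) I (Prod.fst : M × ℍ[ℝ]ˣ → M) p v = a ∧ dq I M p ![v] = h :=
  ⟨(⟨a, h⟩ : E × ℍ[ℝ]), mfderiv_fst_apply (E := E) p ⟨a, h⟩, dq_apply (E := E) p ⟨a, h⟩⟩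

theorem dFun_comp_fst [IsManifold I ∞ M] {f : M → ℍ[ℝ]} (hf : ContMDiff I 𝓘(ℝ, ℍ[ℝ]) ∞ f) :
    dFun (I.prod 𝓘(ℝ, ℍ[ℝ])) (fun p : M × ℍ[ℝ]ˣ => f p.1) = (dFun I f).lift := by
  refine Form.ext_one fun p v => ?_
  have h := mfderiv_comp (I := I.prod 𝓘(ℝ, ℍ[ℝ])) p (hf.mdifferentiableAt (x := p.1) (by simp))
    (mdifferentiableAt_fst (I := I) (I' := 𝓘(ℝ, ℍ[ℝ])) (x := p))
  exact congrArg (fun L : E × ℍ[ℝ] →L[ℝ] ℍ[ℝ] => L v) h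

variable [I.Boundaryless] [IsManifold I ∞ M]

/-- The differential of `q α q̄` for a `1`-form `α` on the base. -/
theorem Form.d_fib_mul_lift_mul_star_fib_apply {α : Form I M 1 ℍ[ℝ]} (hα : α.IsSmooth)
    (p : M × ℍ[ℝ]ˣ) (v w : TangentSpace (I.prod 𝓘(ℝ, ℍ[ℝ])) p) :
    Form.d (Form.mulRight (Form.mulLeft (fib M) α.lift) fun p => star (fib M p)) p ![v, w] =
      (dq I M p ![v] * α.lift p ![w] - dq I M p ![w] * α.lift p ![v]
          + fib M p * (Form.d α).lift p ![v, w]) * star (fib M p)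
        - (fib M p * α.lift p ![v] * star (dq I M p ![w])
          - fib M p * α.lift p ![w] * star (dq I M p ![v])) := by
  have hq := contMDiff_fib (I := I) (M := M)
  rw [Form.d_mulRight (Form.IsSmooth.mulLeft hq hα.lift) (ContMDiff.quaternion_star hq),
    Form.d_mulLeft hq hα.lift, Form.d_lift hα, dFun_star hq]
  simp only [Form.sub_apply, Form.mulRight_apply, Form.add_apply, Form.mulLeft_apply,
    Form.wedge_apply_one_add_one, Form.conj_apply]
  rfl

namespace QKStructure

variable (Q : QKStructure I M)

theorem star_conn (x : M) (v : TangentSpace I x) : star (Q.conn x ![v]) = -Q.conn x ![v] :=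
  Quaternion.star_eq_neg.2 (Q.conn_im x v)

/-- As `ω` is imaginary, the conjugate of `q ω` is `-ω q̄`. -/
theorem θ_conj_eq : Q.θ.conj =
    dFun (I.prod 𝓘(ℝ, ℍ[ℝ])) (fun p => star (fib M p)) +
      Form.mulRight Q.conn.lift (fun p => star (fib M p)) := by
  refine Form.ext_one fun p v => ?_
  rw [dFun_star (contMDiff_fib (I := I) (M := M))]
  simp only [Form.conj_apply, θ, Form.sub_apply, Form.mulLeft_apply, Form.add_apply,
    Form.mulRight_apply, star_sub, star_mul, Form.lift_one_apply, star_conn]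
  rw [neg_mul, sub_neg_eq_add]
  rfl

theorem isSmooth_θ_conj : Q.θ.conj.IsSmooth := by
  have hq := ContMDiff.quaternion_star (contMDiff_fib (I := I) (M := M))
  rw [θ_conj_eq]
  exact (Form.isSmooth_dFun hq).add (Q.conn_smooth.lift.mulRight hq)

/-- The hyperkähler form of the Swann bundle is exact. -/
theorem Ω_eq_d : Q.Ω = Form.d (Form.mulLeft (fib M) Q.θ.conj) := by
  have hq := contMDiff_fib (I := I) (M := M)
  have hs := ContMDiff.quaternion_star hq
  refine Form.ext_two fun p v w => ?_
  -- `d(q θ̄) = dq ∧ θ̄ + q (dω q̄ - ω ∧ dq̄)`; inserting `dω = s Θ - ω ∧ ω` collects the rest into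
  -- `s q Θ q̄ + θ ∧ θ̄`.
  rw [Form.d_mulLeft hq Q.isSmooth_θ_conj, θ_conj_eq, Form.d_add (Form.isSmooth_dFun hs)
    (Q.conn_smooth.lift.mulRight hs), Form.d_dFun hs, Form.d_mulRight Q.conn_smooth.lift hs,
    Form.d_lift Q.conn_smooth, Ω, θ_conj_eq]
  simp only [Form.add_apply, Form.sub_apply, Form.smul_apply, Form.mulRight_apply,
    Form.mulLeft_apply, Form.wedge_apply_one_add_one, Form.zero_apply, Form.lift_one_add_one_apply,
    Form.lift_one_apply, θ, Q.d_conn_apply, dq]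
  simp only [← mul_smul_comm]
  noncomm_ring

theorem d_Ω : Form.d Q.Ω = 0 := by
  rw [Ω_eq_d]
  exact Form.d_d (Form.IsSmooth.mulLeft (contMDiff_fib (I := I) (M := M)) Q.isSmooth_θ_conj)

end QKStructure

end Total

/-! ### Invariant fields preserving the hyperkähler form -/

section Preserves

set_option linter.unusedSectionVars false

variable {E H M : Type*} [NormedAddCommGroup E] [NormedSpace ℝ E] [TopologicalSpace H]
  {I : ModelWithCorners ℝ E H} [TopologicalSpace M] [ChartedSpace H M]
  [I.Boundaryless] [IsManifold I ∞ M]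

namespace QKStructure

variable {Q : QKStructure I M} {X : VField (I.prod 𝓘(ℝ, ℍ[ℝ])) (M × ℍ[ℝ]ˣ)} {XH : VField I M}
  {R : M → ℍ[ℝ]}

theorem preserves_iff : Q.Preserves X ↔ Form.d (Form.contract X Q.Ω) = 0 := by
  have h0 : Form.contract X (0 : Form (I.prod 𝓘(ℝ, ℍ[ℝ])) (M × ℍ[ℝ]ˣ) 3 ℍ[ℝ]) = 0 :=
    Form.ext_two fun p v w => rfl
  rw [Preserves, Form.lie, d_Ω, h0, add_zero]

theorem θ_vertical (hH : HasHorizontalPart X XH) (hV : HasVerticalPart X R) (p : M × ℍ[ℝ]ˣ) :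
    Q.θ p ![X p] = -(fib M p * Q.baseMoment XH R p.1) := by
  have hm : Q.baseMoment XH R p.1 = Q.conn p.1 ![XH p.1] + R p.1 := rfl
  rw [θ, Form.sub_apply, Form.mulLeft_apply, Form.lift_one_apply, hH p, hV p, hm]
  noncomm_ring

theorem θ_apply (p : M × ℍ[ℝ]ˣ) (v : TangentSpace (I.prod 𝓘(ℝ, ℍ[ℝ])) p) :
    Q.θ p ![v] = dq I M p ![v] - fib M p * Q.conn.lift p ![v] := rfl

/-- The contraction of an invariant vector field with the hyperkähler form. -/
theorem contract_Ω (hH : HasHorizontalPart X XH) (hV : HasVerticalPart X R) :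
    Form.contract X Q.Ω =
      Form.mulRight (Form.mulLeft (fib M) (Form.lift (Q.s • Form.contract XH Q.Θ
        - Form.mulLeft (Q.baseMoment XH R) Q.conn
        - Form.mulRight Q.conn (fun x => star (Q.baseMoment XH R x))))) (fun p => star (fib M p))
      - Form.mulLeft (fun p => fib M p * Q.baseMoment XH R p.1)
          (dFun (I.prod 𝓘(ℝ, ℍ[ℝ])) fun p => star (fib M p))
      + Form.mulRight (dq I M) (fun p => star (fib M p * Q.baseMoment XH R p.1)) := by
  refine Form.ext_one fun p v => ?_
  rw [dFun_star contMDiff_fib]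
  simp only [Form.contract_apply, Ω, Form.add_apply, Form.sub_apply, Form.smul_apply,
    Form.mulRight_apply, Form.mulLeft_apply, Form.wedge_apply, Form.conj_apply,
    Form.lift_one_apply, Form.lift_two_apply, θ_vertical hH hV, hH p]
  rw [θ_apply, Form.lift_one_apply]
  simp only [star_neg, star_mul, star_sub, star_conn, dq]
  simp only [← mul_smul_comm]
  noncomm_ring

theorem contMDiff_fib_mul_baseMoment (hX : XH.IsSmooth) (hR : ContMDiff I 𝓘(ℝ, ℍ[ℝ]) ∞ R) :
    ContMDiff (I.prod 𝓘(ℝ, ℍ[ℝ])) 𝓘(ℝ, ℍ[ℝ]) ∞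
      (fun p : M × ℍ[ℝ]ˣ => fib M p * Q.baseMoment XH R p.1) :=
  ContMDiff.quaternion_mul contMDiff_fib ((contMDiff_baseMoment (Q := Q) hX hR).comp contMDiff_fst)

theorem dFun_fib_mul_baseMoment_apply (hX : XH.IsSmooth) (hR : ContMDiff I 𝓘(ℝ, ℍ[ℝ]) ∞ R)
    (p : M × ℍ[ℝ]ˣ) (v : TangentSpace (I.prod 𝓘(ℝ, ℍ[ℝ])) p) :
    dFun (I.prod 𝓘(ℝ, ℍ[ℝ])) (fun p : M × ℍ[ℝ]ˣ => fib M p * Q.baseMoment XH R p.1) p ![v] =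
      dq I M p ![v] * Q.baseMoment XH R p.1
        + fib M p * (dFun I (Q.baseMoment XH R)).lift p ![v] := by
  have hm := contMDiff_baseMoment (Q := Q) hX hR
  have h := dFun_mul (contMDiff_fib (I := I) (M := M)) (hm.comp contMDiff_fst)
  have h2 := dFun_comp_fst hm
  refine (congrArg (fun α : Form (I.prod 𝓘(ℝ, ℍ[ℝ])) (M × ℍ[ℝ]ˣ) 1 ℍ[ℝ] => α p ![v]) h).trans ?_
  rw [← h2]
  rfl

theorem contMDiff_moment (hX : XH.IsSmooth) (hR : ContMDiff I 𝓘(ℝ, ℍ[ℝ]) ∞ R) :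
    ContMDiff (I.prod 𝓘(ℝ, ℍ[ℝ])) 𝓘(ℝ, ℍ[ℝ]) ∞ (Q.moment XH R) :=
  ContMDiff.quaternion_mul (contMDiff_fib_mul_baseMoment hX hR)
    (ContMDiff.quaternion_star contMDiff_fib)

/-- The differential of the contraction of an invariant vector field with the hyperkähler form, on
vertical vectors over the unit section. -/
theorem d_contract_Ω_vertical (hH : HasHorizontalPart X XH) (hV : HasVerticalPart X R)
    (hX : XH.IsSmooth) (hR : ContMDiff I 𝓘(ℝ, ℍ[ℝ]) ∞ R) (p : M × ℍ[ℝ]ˣ)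
    {v w : TangentSpace (I.prod 𝓘(ℝ, ℍ[ℝ])) p}
    (hv : mfderiv (I.prod 𝓘(ℝ, ℍ[ℝ])) I (Prod.fst : M × ℍ[ℝ]ˣ → M) p v = 0)
    (hw : mfderiv (I.prod 𝓘(ℝ, ℍ[ℝ])) I (Prod.fst : M × ℍ[ℝ]ˣ → M) p w = 0) :
    Form.d (Form.contract X Q.Ω) p ![v, w] =
      dq I M p ![w] * (Q.baseMoment XH R p.1 + star (Q.baseMoment XH R p.1))
          * star (dq I M p ![v])
        - dq I M p ![v] * (Q.baseMoment XH R p.1 + star (Q.baseMoment XH R p.1))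
          * star (dq I M p ![w]) := by
  have hm := contMDiff_baseMoment (Q := Q) hX hR
  have hq := contMDiff_fib (I := I) (M := M)
  have hs := ContMDiff.quaternion_star hq
  have hqm := contMDiff_fib_mul_baseMoment (Q := Q) hX hR
  have hA : (Q.s • Form.contract XH Q.Θ - Form.mulLeft (Q.baseMoment XH R) Q.conn
        - Form.mulRight Q.conn (fun x => star (Q.baseMoment XH R x))).IsSmooth :=
    (((Q.Θ_smooth.contract hX).smul Q.s).sub (Form.IsSmooth.mulLeft hm Q.conn_smooth)).sub
      (Q.conn_smooth.mulRight (ContMDiff.quaternion_star hm))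
  have hdq : (dq I M).IsSmooth := Form.isSmooth_dFun hq
  have hddq : Form.d (dq I M) = 0 := Form.d_dFun hq
  have h1 : ∀ α : Form I M 1 ℍ[ℝ], α.lift p ![v] = 0 := fun α => by
    rw [Form.lift_one_apply, hv]
    exact (α p.1).map_coord_zero 0 rfl
  have h2 : ∀ α : Form I M 1 ℍ[ℝ], α.lift p ![w] = 0 := fun α => by
    rw [Form.lift_one_apply, hw]
    exact (α p.1).map_coord_zero 0 rfl
  have h3 : ∀ α : Form I M (1 + 1) ℍ[ℝ], α.lift p ![v, w] = 0 := fun α => by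
    rw [Form.lift_one_add_one_apply, hv]
    exact (α p.1).map_coord_zero 0 rfl
  rw [contract_Ω hH hV, Form.d_add (((Form.IsSmooth.mulLeft hq hA.lift).mulRight hs).sub
      (Form.IsSmooth.mulLeft hqm (Form.isSmooth_dFun hs)))
      (hdq.mulRight (ContMDiff.quaternion_star hqm)),
    Form.d_sub ((Form.IsSmooth.mulLeft hq hA.lift).mulRight hs)
      (Form.IsSmooth.mulLeft hqm (Form.isSmooth_dFun hs)),
    Form.d_mulLeft hqm (Form.isSmooth_dFun hs), Form.d_dFun hs,
    Form.d_mulRight hdq (ContMDiff.quaternion_star hqm), hddq,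
    dFun_star hqm, dFun_star hq]
  simp only [Form.add_apply, Form.sub_apply, Form.d_fib_mul_lift_mul_star_fib_apply hA, h1, h2, h3,
    Form.mulLeft_apply, Form.mulRight_apply, Form.zero_apply, Form.wedge_apply_one_add_one,
    Form.conj_apply, dFun_fib_mul_baseMoment_apply hX hR, dq, star_add, star_mul, star_zero]
  noncomm_ring

theorem isIm_of_preserves (hH : HasHorizontalPart X XH) (hV : HasVerticalPart X R)
    (hX : XH.IsSmooth) (hR : ContMDiff I 𝓘(ℝ, ℍ[ℝ]) ∞ R) (h : Q.Preserves X) : IsIm R := by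
  intro x
  rw [preserves_iff] at h
  -- With `dq(v) = i` and `dq(w) = 1`, the `i` component of `d(i_X Ω)(v, w)` is `-4 Re m`, and `Re m
  -- = Re R` because `ω` is imaginary.
  obtain ⟨i, hi⟩ : ∃ i : ℍ[ℝ], i.imI = 1 := ⟨⟨0, 1, 0, 0⟩, rfl⟩
  obtain ⟨v, hv, hv'⟩ := exists_tangent (I := I) ((x, 1) : M × ℍ[ℝ]ˣ) 0 i
  obtain ⟨w, hw, hw'⟩ := exists_tangent (I := I) ((x, 1) : M × ℍ[ℝ]ˣ) 0 1
  have h1 := d_contract_Ω_vertical (Q := Q) hH hV hX hR (x, 1) hv hw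
  rw [h, hv', hw', Form.zero_apply] at h1
  have hm : (Q.baseMoment XH R x).re = (R x).re :=
    (congrArg (· + (R x).re) (Q.conn_im x (XH x))).trans (zero_add _)
  have h2 := congrArg QuaternionAlgebra.imI h1
  simp only [one_mul, star_one, mul_one, Quaternion.self_add_star', hm, Quaternion.imI_sub, Quaternion.imI_mul, Quaternion.imI_star,
    Quaternion.re_coe, Quaternion.imI_coe, Quaternion.imJ_coe, Quaternion.imK_coe,
    Quaternion.imI_zero, hi] at h2
  linarith

/-- For imaginary `m`, `m̄ = -m`. The terms of `i_X Ω` containing `dq` and `dq̄` then belong to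
`-d(q m q̄)`, and the missing `q dm q̄` completes the base part to `q η q̄`. -/
theorem contract_Ω_of_isIm (hH : HasHorizontalPart X XH) (hV : HasVerticalPart X R)
    (hX : XH.IsSmooth) (hR : ContMDiff I 𝓘(ℝ, ℍ[ℝ]) ∞ R) (hIm : IsIm R) :
    Form.contract X Q.Ω =
      Form.mulRight (Form.mulLeft (fib M) (Q.defect XH R).lift) (fun p => star (fib M p))
        - dFun (I.prod 𝓘(ℝ, ℍ[ℝ])) (Q.moment XH R) := by
  have hqm := contMDiff_fib_mul_baseMoment (Q := Q) hX hR
  have hs := ContMDiff.quaternion_star (contMDiff_fib (I := I) (M := M))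
  have hst : ∀ x, star (Q.baseMoment XH R x) = -Q.baseMoment XH R x := fun x =>
    Quaternion.star_eq_neg.2 (baseMoment_re hIm x)
  refine Form.ext_one fun p v => ?_
  have hμ := congrArg (fun α : Form (I.prod 𝓘(ℝ, ℍ[ℝ])) (M × ℍ[ℝ]ˣ) 1 ℍ[ℝ] => α p ![v])
    (dFun_mul hqm hs)
  simp only [Form.add_apply, Form.mulLeft_apply, Form.mulRight_apply,
    dFun_fib_mul_baseMoment_apply hX hR] at hμ
  rw [Form.sub_apply, show dFun (I.prod 𝓘(ℝ, ℍ[ℝ])) (Q.moment XH R) p ![v] = _ from hμ,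
    contract_Ω hH hV]
  simp only [Form.add_apply, Form.sub_apply, Form.smul_apply, Form.mulRight_apply,
    Form.mulLeft_apply, Form.lift_one_apply, defect, star_mul, hst]
  noncomm_ring

/-- An invariant vector field preserves the hyperkähler form if and only if its vertical part is
imaginary and its defect vanishes. -/
theorem preserves_iff_defect (hH : HasHorizontalPart X XH) (hV : HasVerticalPart X R)
    (hX : XH.IsSmooth) (hR : ContMDiff I 𝓘(ℝ, ℍ[ℝ]) ∞ R) :
    Q.Preserves X ↔ IsIm R ∧ Q.defect XH R = 0 := by
  have hη := isSmooth_defect (Q := Q) hX hR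
  have hq := contMDiff_fib (I := I) (M := M)
  have key : IsIm R → Form.d (Form.contract X Q.Ω) = Form.d (Form.mulRight
      (Form.mulLeft (fib M) (Q.defect XH R).lift) (fun p => star (fib M p))) := fun hIm => by
    rw [contract_Ω_of_isIm hH hV hX hR hIm, Form.d_sub ((Form.IsSmooth.mulLeft hq hη.lift).mulRight
      (ContMDiff.quaternion_star hq)) (Form.isSmooth_dFun (contMDiff_moment hX hR)),
      Form.d_dFun (contMDiff_moment hX hR), sub_zero]
  constructor
  · intro h
    have hIm := isIm_of_preserves hH hV hX hR h
    refine ⟨hIm, Form.ext_one fun x a => ?_⟩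
    rw [preserves_iff, key hIm] at h
    -- At `q = 1`, with `v` vertical, `dq(v) = 1`, and `w` over `a`, `dq(w) = 0`, both Leibniz terms
    -- of `d(q η q̄)(v, w)` equal `η(a)` and the `dη` term vanishes.
    obtain ⟨v, hv, hv'⟩ := exists_tangent (I := I) ((x, 1) : M × ℍ[ℝ]ˣ) 0 1
    obtain ⟨w, hw, hw'⟩ := exists_tangent (I := I) ((x, 1) : M × ℍ[ℝ]ˣ) a 0
    have h1 := Form.d_fib_mul_lift_mul_star_fib_apply hη (x, 1) v w
    have h2 : (Q.defect XH R).lift (x, 1) ![v] = 0 := by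
      rw [Form.lift_one_apply, hv]
      exact (Q.defect XH R x).map_coord_zero 0 rfl
    have h3 : (Form.d (Q.defect XH R)).lift (x, 1) ![v, w] = 0 := by
      rw [Form.lift_one_add_one_apply, hv]
      exact (Form.d (Q.defect XH R) x).map_coord_zero 0 rfl
    rw [h, hv', hw', h2, h3, Form.lift_one_apply, hw] at h1
    have hf : fib M ((x, 1) : M × ℍ[ℝ]ˣ) = 1 := rfl
    simp only [Form.zero_apply, hf, star_one, star_zero, one_mul, mul_one, mul_zero,
      sub_zero, add_zero, zero_sub, sub_neg_eq_add] at h1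
    rw [← two_smul ℝ] at h1
    exact (smul_eq_zero.1 h1.symm).resolve_left two_ne_zero
  · rintro ⟨hIm, h⟩
    rw [preserves_iff, key hIm, h]
    refine Eq.trans (congrArg Form.d (Form.ext_one fun p v => ?_)) Form.d_zero
    have h0 : (0 : Form I M 1 ℍ[ℝ]).lift p ![v] = 0 := rfl
    rw [Form.mulRight_apply, Form.mulLeft_apply, h0, mul_zero, zero_mul]
    rfl

theorem isMomentMap (hH : HasHorizontalPart X XH) (hV : HasVerticalPart X R)
    (hX : XH.IsSmooth) (hR : ContMDiff I 𝓘(ℝ, ℍ[ℝ]) ∞ R) (h : Q.Preserves X) :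
    Q.IsMomentMap X (Q.moment XH R) := by
  obtain ⟨hIm, hη⟩ := (preserves_iff_defect hH hV hX hR).1 h
  refine ⟨contMDiff_moment hX hR, fun p => ?_, ?_⟩
  · have := baseMoment_re (Q := Q) (XH := XH) hIm p.1
    simp only [moment, Quaternion.re_mul, Quaternion.imI_mul, Quaternion.imJ_mul,
      Quaternion.imK_mul, Quaternion.re_star, Quaternion.imI_star, Quaternion.imJ_star,
      Quaternion.imK_star, this]
    ring
  · rw [contract_Ω_of_isIm hH hV hX hR hIm, hη]
    refine Form.ext_one fun p v => ?_
    have h0 : (0 : Form I M 1 ℍ[ℝ]).lift p ![v] = 0 := rfl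
    rw [Form.neg_apply, Form.sub_apply, Form.mulRight_apply, Form.mulLeft_apply, h0, mul_zero,
      zero_mul, zero_sub, neg_neg]

end QKStructure

end Preserves

/-! ### Invariant vector fields and their parts -/

section Invariant

set_option linter.unusedSectionVars false

variable {E H M : Type*} [NormedAddCommGroup E] [NormedSpace ℝ E] [TopologicalSpace H]
  {I : ModelWithCorners ℝ E H} [TopologicalSpace M] [ChartedSpace H M]

theorem contMDiff_act (u : ℍ[ℝ]ˣ) : ContMDiff (I.prod 𝓘(ℝ, ℍ[ℝ])) (I.prod 𝓘(ℝ, ℍ[ℝ])) ∞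
    (act u : M × ℍ[ℝ]ˣ → M × ℍ[ℝ]ˣ) :=
  contMDiff_fst.prodMk ((contMDiff_mul_left (I := 𝓘(ℝ, ℍ[ℝ])) (n := ∞) (a := u)).comp contMDiff_snd)

theorem mfderiv_fst_mfderiv_act (u : ℍ[ℝ]ˣ) (p : M × ℍ[ℝ]ˣ)
    (v : TangentSpace (I.prod 𝓘(ℝ, ℍ[ℝ])) p) :
    mfderiv (I.prod 𝓘(ℝ, ℍ[ℝ])) I (Prod.fst : M × ℍ[ℝ]ˣ → M) (act u p)
      (mfderiv (I.prod 𝓘(ℝ, ℍ[ℝ])) (I.prod 𝓘(ℝ, ℍ[ℝ])) (act u) p v) =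
    mfderiv (I.prod 𝓘(ℝ, ℍ[ℝ])) I (Prod.fst : M × ℍ[ℝ]ˣ → M) p v := by
  have h := mfderiv_comp (I := I.prod 𝓘(ℝ, ℍ[ℝ])) p (g := (Prod.fst : M × ℍ[ℝ]ˣ → M))
    (mdifferentiableAt_fst (I := I) (I' := 𝓘(ℝ, ℍ[ℝ])))
    ((contMDiff_act (I := I) u).mdifferentiableAt (x := p) (by simp))
  exact (congrArg (fun L : E × ℍ[ℝ] →L[ℝ] E => L v) h).symm

theorem dq_mfderiv_act (u : ℍ[ℝ]ˣ) (p : M × ℍ[ℝ]ˣ) (v : TangentSpace (I.prod 𝓘(ℝ, ℍ[ℝ])) p) :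
    dq I M (act u p) ![mfderiv (I.prod 𝓘(ℝ, ℍ[ℝ])) (I.prod 𝓘(ℝ, ℍ[ℝ])) (act u) p v] =
      u * dq I M p ![v] := by
  have hq : MDifferentiable (I.prod 𝓘(ℝ, ℍ[ℝ])) 𝓘(ℝ, ℍ[ℝ]) (fib M) :=
    contMDiff_fib.mdifferentiable (by simp)
  have h := mfderiv_comp (I := I.prod 𝓘(ℝ, ℍ[ℝ])) p (hq (act u p))
    ((contMDiff_act (I := I) u).mdifferentiableAt (x := p) (by simp))
  have hL : MDifferentiableAt 𝓘(ℝ, ℍ[ℝ]) 𝓘(ℝ, ℍ[ℝ])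
      (ContinuousLinearMap.mul ℝ ℍ[ℝ] (u : ℍ[ℝ])) (fib M p) :=
    (ContinuousLinearMap.differentiableAt _).mdifferentiableAt
  have h2 := mfderiv_comp (I := I.prod 𝓘(ℝ, ℍ[ℝ])) p hL (hq p)
  rw [mfderiv_eq_fderiv, ContinuousLinearMap.fderiv] at h2
  have h3 : fib M ∘ act u = ContinuousLinearMap.mul ℝ ℍ[ℝ] (u : ℍ[ℝ]) ∘ fib M := rfl
  rw [h3] at h
  exact (congrArg (fun L : E × ℍ[ℝ] →L[ℝ] ℍ[ℝ] => L v) h).symm.trans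
    (congrArg (fun L : E × ℍ[ℝ] →L[ℝ] ℍ[ℝ] => L v) h2)

/-- The vector field on `M × ℍˣ` with horizontal part `XH` and vertical part `-q R`. -/
def invariantField (XH : VField I M) (R : M → ℍ[ℝ]) : VField (I.prod 𝓘(ℝ, ℍ[ℝ])) (M × ℍ[ℝ]ˣ) :=
  fun p => (⟨XH p.1, -(fib M p * R p.1)⟩ : E × ℍ[ℝ])

variable {XH : VField I M} {R : M → ℍ[ℝ]} {X : VField (I.prod 𝓘(ℝ, ℍ[ℝ])) (M × ℍ[ℝ]ˣ)}

theorem hasHorizontalPart_invariantField : HasHorizontalPart (invariantField XH R) XH := fun p =>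
  mfderiv_fst_apply (E := E) p _

theorem hasVerticalPart_invariantField : HasVerticalPart (invariantField XH R) R := fun p =>
  dq_apply (E := E) p _

theorem eq_of_parts {X' : VField (I.prod 𝓘(ℝ, ℍ[ℝ])) (M × ℍ[ℝ]ˣ)} (hH : HasHorizontalPart X XH)
    (hV : HasVerticalPart X R) (hH' : HasHorizontalPart X' XH) (hV' : HasVerticalPart X' R) :
    X = X' :=
  funext fun p => tangent_ext ((hH p).trans (hH' p).symm) ((hV p).trans (hV' p).symm)

theorem commutesWithAction_invariantField : CommutesWithAction (invariantField XH R) := by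
  intro u p
  refine tangent_ext ?_ ?_
  · rw [mfderiv_fst_mfderiv_act, hasHorizontalPart_invariantField,
      hasHorizontalPart_invariantField]
    rfl
  · rw [dq_mfderiv_act, hasVerticalPart_invariantField, hasVerticalPart_invariantField, mul_neg,
      ← mul_assoc]
    rfl

variable [IsManifold I ∞ M]

/-- `ℍˣ` carries a single chart, so its tangent trivializations are the identity on fibres and
smoothness of a lift reduces to that of its two components. -/
theorem contMDiff_tangent_units {f : M → ℍ[ℝ]ˣ} (hf : ContMDiff I 𝓘(ℝ, ℍ[ℝ]) ∞ f)
    {w : M → ℍ[ℝ]} (hw : ContMDiff I 𝓘(ℝ, ℍ[ℝ]) ∞ w) :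
    ContMDiff I 𝓘(ℝ, ℍ[ℝ]).tangent ∞
      (fun x => (⟨f x, w x⟩ : TangentBundle 𝓘(ℝ, ℍ[ℝ]) ℍ[ℝ]ˣ)) := by
  intro x₀
  refine (Bundle.contMDiffAt_totalSpace (IB := 𝓘(ℝ, ℍ[ℝ]))).2 ⟨hf x₀, ?_⟩
  refine (hw x₀).congr_of_eventuallyEq (Filter.Eventually.of_forall fun x => ?_)
  rw [TangentBundle.trivializationAt_eq_localTriv]
  exact (tangentBundleCore 𝓘(ℝ, ℍ[ℝ]) ℍ[ℝ]ˣ).coordChange_self (achart ℍ[ℝ] (f x₀)) (f x)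
    (Set.mem_univ _) (w x)

theorem isSmooth_invariantField (hX : XH.IsSmooth) (hR : ContMDiff I 𝓘(ℝ, ℍ[ℝ]) ∞ R) :
    (invariantField XH R).IsSmooth := by
  have h1 : ContMDiff (I.prod 𝓘(ℝ, ℍ[ℝ])) I.tangent ∞
      (fun p : M × ℍ[ℝ]ˣ => (⟨p.1, XH p.1⟩ : TangentBundle I M)) := hX.comp contMDiff_fst
  have h2 := contMDiff_tangent_units (I := I.prod 𝓘(ℝ, ℍ[ℝ])) (M := M × ℍ[ℝ]ˣ) (f := Prod.snd)
    contMDiff_snd (w := fun p => -(fib M p * R p.1))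
    (ContMDiff.quaternion_mul contMDiff_fib (hR.comp contMDiff_fst)).neg
  exact contMDiff_equivTangentBundleProd_symm.comp (h1.prodMk h2)

/-- An invariant vector field on `M × ℍˣ` is determined by its horizontal part and by a
quaternionic function on the base. -/
theorem CommutesWithAction.exists_parts [I.Boundaryless] (hX : X.IsSmooth)
    (h : CommutesWithAction X) :
    ∃ (XH : VField I M) (R : M → ℍ[ℝ]), XH.IsSmooth ∧ ContMDiff I 𝓘(ℝ, ℍ[ℝ]) ∞ R ∧
      HasHorizontalPart X XH ∧ HasVerticalPart X R := by
  have hs : ContMDiff I (I.prod 𝓘(ℝ, ℍ[ℝ])) ∞ (fun x : M => ((x, 1) : M × ℍ[ℝ]ˣ)) :=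
    contMDiff_id.prodMk contMDiff_const
  -- The action of `q` carries the unit section to the point `(x, q)`, so invariance recovers `X`
  -- from its values at `(x, 1)`.
  have hp : ∀ p : M × ℍ[ℝ]ˣ, act p.2 (p.1, 1) = p := fun p => Prod.ext rfl (mul_one p.2)
  refine ⟨fun x => mfderiv (I.prod 𝓘(ℝ, ℍ[ℝ])) I (Prod.fst : M × ℍ[ℝ]ˣ → M) (x, 1) (X (x, 1)),
    fun x => -dq I M (x, 1) ![X (x, 1)], ?_, ?_, fun p => ?_, fun p => ?_⟩
  · have h1 : ContMDiff (I.prod 𝓘(ℝ, ℍ[ℝ])).tangent I.tangent ∞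
        (tangentMap (I.prod 𝓘(ℝ, ℍ[ℝ])) I (Prod.fst : M × ℍ[ℝ]ˣ → M)) :=
      ContMDiff.contMDiff_tangentMap (n := ∞) contMDiff_fst (by simp)
    exact h1.comp (hX.comp hs)
  · exact ((Form.contMDiff_contractOne (Form.isSmooth_dFun contMDiff_fib) hX).comp hs).neg
  · have key : ∀ p', p' = p → @Eq E
        (mfderiv (I.prod 𝓘(ℝ, ℍ[ℝ])) I (Prod.fst : M × ℍ[ℝ]ˣ → M) p (X p))
        (mfderiv (I.prod 𝓘(ℝ, ℍ[ℝ])) I (Prod.fst : M × ℍ[ℝ]ˣ → M) p' (X p')) := by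
      rintro _ rfl
      rfl
    refine (key _ (hp p)).trans ?_
    rw [← h]
    exact mfderiv_fst_mfderiv_act p.2 (p.1, 1) (X (p.1, 1))
  · have key : ∀ p', p' = p → dq I M p ![X p] = dq I M p' ![X p'] := by
      rintro _ rfl
      rfl
    rw [key _ (hp p), ← h, dq_mfderiv_act, mul_neg, neg_neg]
    rfl

end Invariant

/-! ### Uniqueness of the parts -/

section Uniqueness

set_option linter.unusedSectionVars false

variable {E H M : Type*} [NormedAddCommGroup E] [NormedSpace ℝ E] [TopologicalSpace H]
  {I : ModelWithCorners ℝ E H} [TopologicalSpace M] [ChartedSpace H M]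
  {Q : QKStructure I M} {XH : VField I M} {R R' : M → ℍ[ℝ]}

theorem QKStructure.Rotates.unique [Nontrivial E] (h : Q.Rotates XH R) (h' : Q.Rotates XH R')
    (hR : IsIm R) (hR' : IsIm R') : R = R' := by
  funext x
  refine sub_eq_zero.1 (Q.eq_zero_of_commute (x := x) ?_ fun v w => ?_)
  · rw [Quaternion.re_sub, hR x, hR' x, sub_zero]
  · have e := congrArg (fun α : Form I M 2 ℍ[ℝ] => α x ![v, w])
      ((show _ = _ from h).symm.trans h')
    simp only [Form.sub_apply, Form.mulLeft_apply, Form.mulRight_apply] at e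
    rw [sub_mul, mul_sub, sub_eq_sub_iff_add_eq_add]
    rw [sub_eq_sub_iff_add_eq_add] at e
    rw [e, add_comm]

theorem HasHorizontalPart.unique {X : VField (I.prod 𝓘(ℝ, ℍ[ℝ])) (M × ℍ[ℝ]ˣ)} {XH' : VField I M}
    (h : HasHorizontalPart X XH) (h' : HasHorizontalPart X XH') : XH = XH' :=
  funext fun x => (h (x, 1)).symm.trans (h' (x, 1))

end Uniqueness

end Swann

end

open Swann in
theorem mainTheorem3 {n : ℕ} (hn : 0 < n) {M : Type*} [TopologicalSpace M]
    [ChartedSpace (EuclideanSpace ℝ (Fin (4 * n))) M] [IsManifold (𝓡 (4 * n)) ∞ M]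
    (Q : QKStructure (𝓡 (4 * n)) M) :
    (∀ X : VField ((𝓡 (4 * n)).prod 𝓘(ℝ, ℍ[ℝ])) (M × ℍ[ℝ]ˣ),
      X.IsSmooth → CommutesWithAction X →
      ∃ (XH : VField (𝓡 (4 * n)) M) (R : M → ℍ[ℝ]),
        XH.IsSmooth ∧ ContMDiff (𝓡 (4 * n)) 𝓘(ℝ, ℍ[ℝ]) ∞ R ∧
        HasHorizontalPart X XH ∧ HasVerticalPart X R ∧
        (Q.Preserves X ↔ IsIm R ∧ Q.Rotates XH R) ∧
        (Q.Preserves X ↔ IsIm R ∧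
          dFun (𝓡 (4 * n)) R + Form.mulRight Q.conn R - Form.mulLeft R Q.conn = -Form.lie XH Q.conn) ∧
        (Q.Preserves X →
          Q.IsMomentMap X (Q.moment XH R) ∧
          dFun (𝓡 (4 * n)) (Q.baseMoment XH R) + Form.mulRight Q.conn (Q.baseMoment XH R)
            - Form.mulLeft (Q.baseMoment XH R) Q.conn = -(Q.s • Form.contract XH Q.Θ))) ∧
    (∀ (XH : VField (𝓡 (4 * n)) M) (R : M → ℍ[ℝ]),
      XH.IsSmooth → ContMDiff (𝓡 (4 * n)) 𝓘(ℝ, ℍ[ℝ]) ∞ R → IsIm R → Q.Rotates XH R →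
      ∃ X : VField ((𝓡 (4 * n)).prod 𝓘(ℝ, ℍ[ℝ])) (M × ℍ[ℝ]ˣ),
        (X.IsSmooth ∧ CommutesWithAction X ∧ HasHorizontalPart X XH ∧ Q.Preserves X) ∧
        HasVerticalPart X R ∧ Q.IsMomentMap X (Q.moment XH R) ∧
        ∀ X' : VField ((𝓡 (4 * n)).prod 𝓘(ℝ, ℍ[ℝ])) (M × ℍ[ℝ]ˣ),
          X'.IsSmooth ∧ CommutesWithAction X' ∧ HasHorizontalPart X' XH ∧ Q.Preserves X' →
          X' = X) := by
  refine ⟨fun X hX hc => ?_, fun XH R hXH hR hIm hrot => ?_⟩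
  · obtain ⟨XH, R, hXH, hR, hH, hV⟩ := hc.exists_parts hX
    have hP := QKStructure.preserves_iff_defect (Q := Q) hH hV hXH hR
    refine ⟨XH, R, hXH, hR, hH, hV, ?_, ?_, fun h => ⟨?_, ?_⟩⟩
    · exact hP.trans (and_congr_right fun hIm => (QKStructure.rotates_iff hXH hR hIm).symm)
    · rw [hP, QKStructure.defect_eq_zero_iff_lie hXH hR]
    · exact QKStructure.isMomentMap hH hV hXH hR h
    · exact QKStructure.defect_eq_zero_iff.1 (hP.1 h).2
  · have hH := hasHorizontalPart_invariantField (XH := XH) (R := R)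
    have hV := hasVerticalPart_invariantField (XH := XH) (R := R)
    have hP : Q.Preserves (invariantField XH R) :=
      (QKStructure.preserves_iff_defect hH hV hXH hR).2
        ⟨hIm, (QKStructure.rotates_iff hXH hR hIm).1 hrot⟩
    refine ⟨invariantField XH R, ⟨isSmooth_invariantField hXH hR,
      commutesWithAction_invariantField, hH, hP⟩, hV, QKStructure.isMomentMap hH hV hXH hR hP, ?_⟩
    rintro X' ⟨hX', hc, hH', hP'⟩
    -- A competing field has its own function `R'`, which is imaginary and satisfies the same
    -- rotation equation over `XH`.
    obtain ⟨XH', R', hXH', hR', hH'', hV'⟩ := hc.exists_parts hX'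
    obtain rfl := hH'.unique hH''
    obtain ⟨hIm', hd⟩ := (QKStructure.preserves_iff_defect hH'' hV' hXH hR').1 hP'
    -- Here `n ≥ 1` enters: on a zero tangent space `Θ` vanishes and could not distinguish `R` from
    -- `R'`.
    have : Nonempty (Fin (4 * n)) := ⟨⟨0, by omega⟩⟩
    obtain rfl := hrot.unique ((QKStructure.rotates_iff hXH hR' hIm').2 hd) hIm hIm'
    exact eq_of_parts hH'' hV' hH hV
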